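/- For $\lambda,\mu\in\mathbb R$ and $g\in L^2(\mathbb R)$ put $\pi_{\lambda,\mu}g(t)=e^{2\pi i\lambda t}g(t-\mu)$. For $M\in\mathbb N$ let $\mathcal K_1(M)$ be the class of rational functions of the form $$g(t)=\sum_{k=1}^{N}\frac{a_k}{(t-iw_k)^{j_k}},\qquad a_k\in\mathbb C,\quad w_k\in\mathbb C\setminus i\mathbb R,\quad j_k\ge 1,\quad \sum_{k=1}^N j_k=M,$$ such that $$\sum_{k=1}^N a_k e^{2\pi w_k t}\,\frac{(2\pi i)^{j_k-1}}{(j_k-1)!}\,t^{j_k-1}\neq 0\quad\text{for every } t<0 .$$ Theorem. For every $\varepsilon>0$ and every $M\in\mathbb N$ there is a set $\Lambda=\Lambda(\varepsilon,M)\subset\mathbb R$ whose upper density $$D(\Lambda)=\lim_{a\to\infty}\sup_{R\in\mathbb R}\frac{\#(\Lambda\cap[R,R+a])}{a}$$ exists and satisfies $D(\Lambda)\le 1+\varepsilon$, such that for every $g\in\mathcal K_1(M)$ the Gabor system $\{\pi_{\lambda,n}g:(\lambda,n)\in\Lambda\times\mathbb Z\}$ is a frame in $L^2(\mathbb R)$;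 that is, $g\in L^2(\mathbb R)$ and there are constants $A,B>0$ (which may depend on $g$) with $$A\|f\|_2^2\le\sum_{(\lambda,n)\in\Lambda\times\mathbb Z}|(f,\pi_{\lambda,n}g)|^2\le B\|f\|_2^2\qquad\text{for all } f\in L^2(\mathbb R).$$ -/

import Mathlib

open MeasureTheory Filter Topology
open scoped ENNReal

noncomputable section

/-- The time-frequency shift `(π_{lam, mu} g)(t) = e^{2 π i lam t} g (t - mu)`. -/
def timeFreqShift (lam mu : ℝ) (g : ℝ → ℂ) (t : ℝ) : ℂ :=
  Complex.exp (2 * (Real.pi : ℂ) * Complex.I * (lam : ℂ) * (t : ℂ)) * g (t - mu)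

/-- The inner product `(f, h) = ∫ f(t) * conj (h(t)) dt` of two square integrable functions. -/
def innerL2 (f h : ℝ → ℂ) : ℂ :=
  ∫ t : ℝ, f t * (starRingEnd ℂ) (h t)

/-- The Gabor system `{π_{lam, mu} g : (lam, mu) ∈ L}`, indexed by `L`, is a frame in `L²(ℝ)`:
the window is square integrable, and for some `A, B > 0` and all `f ∈ L²(ℝ)` the sum of the
`|(f, π_{lam, mu} g)|²` over `L` converges and lies between `A ‖f‖₂²` and `B ‖f‖₂²`. -/
def IsGaborFrame (g : ℝ → ℂ) (L : Set (ℝ × ℝ)) : Prop :=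
  MemLp g 2 volume ∧
  ∃ A B : ℝ, 0 < A ∧ 0 < B ∧ ∀ f : ℝ → ℂ, MemLp f 2 volume →
    Summable (fun p : L => ‖innerL2 f (timeFreqShift p.1.1 p.1.2 g)‖ ^ 2) ∧
    A * ∫ t : ℝ, ‖f t‖ ^ 2 ≤ ∑' p : L, ‖innerL2 f (timeFreqShift p.1.1 p.1.2 g)‖ ^ 2 ∧
    ∑' p : L, ‖innerL2 f (timeFreqShift p.1.1 p.1.2 g)‖ ^ 2 ≤ B * ∫ t : ℝ, ‖f t‖ ^ 2

/-- `Λ` has upper density `D`: the limit, as `a → ∞`, of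
`sup_R #{x ∈ Λ : x ∈ [R, R + a]} / a` exists and equals `D`. -/
def HasUpperDensity (Λ : Set ℝ) (D : ℝ≥0∞) : Prop :=
  Tendsto
    (fun a : ℝ => ⨆ R : ℝ, ((Λ ∩ Set.Icc R (R + a)).encard : ℝ≥0∞) / ENNReal.ofReal a)
    atTop (𝓝 D)

/-- The class `𝒦₁(M)` of rational windows
`g(t) = ∑ₖ aₖ / (t - i wₖ) ^ jₖ` with `aₖ ∈ ℂ`, `wₖ ∈ ℂ ∖ iℝ`, `jₖ ≥ 1`, `∑ₖ jₖ = M`, such that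
`∑ₖ aₖ e^{2 π wₖ t} (2 π i)^{jₖ - 1} / (jₖ - 1)! t^{jₖ - 1} ≠ 0` for every `t < 0`. -/
def RationalWindows (M : ℕ) : Set (ℝ → ℂ) :=
  {g | ∃ (N : ℕ) (a w : Fin N → ℂ) (j : Fin N → ℕ),
    (∀ k, (w k).re ≠ 0) ∧ (∀ k, 1 ≤ j k) ∧ ∑ k, j k = M ∧
    (∀ t : ℝ, g t = ∑ k, a k / ((t : ℂ) - Complex.I * w k) ^ j k) ∧
    ∀ t : ℝ, t < 0 →
      ∑ k, a k * Complex.exp (2 * (Real.pi : ℂ) * w k * (t : ℂ)) *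
        ((2 * (Real.pi : ℂ) * Complex.I) ^ (j k - 1) / ((j k - 1).factorial : ℂ)) *
        (t : ℂ) ^ (j k - 1) ≠ 0}

end

/-!
The frequency set `Λ` consists of all integers and, for a large `K`, of one shifted copy of each
block of `M` consecutive integers that starts at a multiple of `K`. All shifts lie in `(0, 1)`, so
the density is `1 + M / K`. The shift of the block at `K q` is `1 / (v + 2)`, with `v` the 2-adic
valuation of `q`: infinitely many shifts occur, they accumulate at `0`, and each of them recurs with
bounded gaps.

Let `φ` be the Fourier transform of `g`. It decays exponentially and is glued at `0` from two
exponential polynomials `P` (on the right) and `N` (on the left). By Plancherel's theorem and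
Parseval's identity for periodizations (`tsum_enorm_sq_innerL2`), the frame coefficients of `f` with
frequency `l + s` become, for almost every `ξ ∈ (0, 1)`, a correlation of the sequence
`c k = conj F(ξ + k)`, where `F` is the Fourier transform of `f`, with the samples of `φ` along
`ξ - s + ℤ`. The frame inequalities thus reduce to inequalities for sequences, uniform in `ξ`.
The upper one follows from the decay of `φ`.

The lower one rests on uniqueness (`IsDecayPair.eq_zero_of_equations`). The samples of `P` and of
`N` solve a common recurrence of order `M`, so applying it to the samples of `φ` on `ξ + ℤ` leaves
a sequence supported on `M` consecutive integers. It is not zero: by linear independence of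
exponential polynomials, the condition defining `𝒦₁(M)` implies that `φ` has a nonzero sample on
each translate of `ℤ`. If all correlations along `ξ + ℤ` vanish, `c` itself solves a nontrivial
recurrence on `M` consecutive entries; so do the correlations along any other translate of `ℤ`,
which therefore vanish identically as soon as `M` consecutive ones vanish, as the blocks of `Λ`
provide. As the shifts accumulate, the function `y ↦ ∑ c k φ(y + k)`, which is the restriction of
an entire function to each interval between integers, vanishes. Comparing adjacent intervals, whose
entire functions differ by one term `c k (P - N)`, gives `c = 0`.

Uniqueness holds for sequences of small exponential growth. A compactness argument (limits along an
ultrafilter, after translating and normalizing `c`) turns it into a local estimate with exponential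
weights that is uniform in `ξ` and in the place of localization
(`IsDecayPair.exists_local_bound`); recurrence of the shifts with bounded gaps keeps the limiting
equations available. Summing the local estimates absorbs the error term and gives the lower frame
bound.
-/

open scoped FourierTransform

/-! ### Fourier inversion on `L²(ℝ)` for integrable functions -/

theorem coeFn_fourierInv_toLp_ae_eq {Ψ : ℝ → ℂ} (h1 : Integrable Ψ) (h2 : MemLp Ψ 2 volume) :
    ((𝓕⁻ (h2.toLp Ψ) : Lp ℂ 2 (volume : Measure ℝ)) : ℝ → ℂ) =ᵐ[volume] 𝓕⁻ Ψ := by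
  have hcont : Continuous (𝓕⁻ Ψ) :=
    VectorFourier.fourierIntegral_continuous Real.continuous_fourierChar
      (by simp; fun_prop) h1
  apply ae_eq_of_integral_contDiff_smul_eq
  · exact (Lp.memLp _).locallyIntegrable (by norm_num)
  · exact hcont.locallyIntegrable
  · intro g g_smooth g_cpt
    have hg₁ : HasCompactSupport (Complex.ofRealCLM ∘ g) := g_cpt.comp_left rfl
    have hg₂ : ContDiff ℝ (⊤ : ℕ∞) (Complex.ofRealCLM ∘ g) := by fun_prop
    set G : SchwartzMap ℝ ℂ := hg₁.toSchwartzMap hg₂ with hG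
    have e1 := congrArg (fun T => T G) (Lp.fourierInv_toTemperedDistribution_eq (h2.toLp Ψ))
    have e2 : ∫ x, (𝓕⁻ G) x • Ψ x = ∫ x, G x • 𝓕⁻ Ψ x := by
      have := VectorFourier.integral_fourierIntegral_smul_eq_flip (μ := volume) (ν := volume)
        (e := Real.fourierChar) (L := -innerₗ ℝ) (f := G) (g := Ψ)
        Real.continuous_fourierChar
        (by simp; fun_prop) G.integrable h1
      have hflip : (-innerₗ ℝ : ℝ →ₗ[ℝ] ℝ →ₗ[ℝ] ℝ).flip = -innerₗ ℝ := by
        ext; simp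
      rw [hflip] at this
      rw [SchwartzMap.fourierInv_coe]
      exact this
    simp only [TemperedDistribution.fourierInv_apply, Lp.toTemperedDistribution_apply] at e1
    have e3 : ∫ x, (𝓕⁻ G) x • (h2.toLp Ψ) x = ∫ x, (𝓕⁻ G) x • Ψ x := by
      apply integral_congr_ae
      filter_upwards [h2.coeFn_toLp] with x hx
      rw [hx]
    rw [e3, e2] at e1
    have hGg : ∀ x (z : ℂ), G x • z = g x • z := by
      intro x z
      simp [hG]
    simp only [hGg] at e1
    exact e1.symm

/-- The `L²` Fourier transform `F` of `f`, described through Plancherel's theorem: it has the same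
norm, and pairing `f` with the inverse Fourier integral of `Ψ ∈ L¹ ∩ L²` is pairing `F` with `Ψ`. -/
theorem exists_plancherel {f : ℝ → ℂ} (hf : MemLp f 2 volume) :
    ∃ F : ℝ → ℂ, MemLp F 2 volume ∧ ∫⁻ x, ‖F x‖ₑ ^ 2 = ∫⁻ x, ‖f x‖ₑ ^ 2 ∧
      ∀ Ψ : ℝ → ℂ, Integrable Ψ → MemLp Ψ 2 volume →
        innerL2 f (𝓕⁻ Ψ) = ∫ x, F x * (starRingEnd ℂ) (Ψ x) := by
  refine ⟨(𝓕 (hf.toLp f) : Lp ℂ 2 (volume : Measure ℝ)), Lp.memLp _, ?_, ?_⟩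
  · have h := Lp.norm_fourier_eq (hf.toLp f)
    have h' : ‖(𝓕 (hf.toLp f) : Lp ℂ 2 (volume : Measure ℝ))‖ₑ = ‖hf.toLp f‖ₑ := by
      rw [← ofReal_norm, ← ofReal_norm, h]
    rw [Lp.enorm_def, Lp.enorm_def, eLpNorm_congr_ae hf.coeFn_toLp,
      eLpNorm_eq_lintegral_rpow_enorm_toReal (by norm_num) (by norm_num),
      eLpNorm_eq_lintegral_rpow_enorm_toReal (by norm_num) (by norm_num)] at h'
    simpa using ENNReal.rpow_left_injective (by norm_num) h'
  · intro Ψ h1 h2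
    have h := Lp.inner_fourier_eq (𝓕⁻ (h2.toLp Ψ) : Lp ℂ 2 (volume : Measure ℝ)) (hf.toLp f)
    rw [FourierTransform.fourier_fourierInv_eq, L2.inner_def, L2.inner_def] at h
    have e1 : ∫ a, inner ℂ ((h2.toLp Ψ) a) ((𝓕 (hf.toLp f) : Lp ℂ 2 (volume : Measure ℝ)) a) =
        ∫ x, (𝓕 (hf.toLp f) : Lp ℂ 2 (volume : Measure ℝ)) x * (starRingEnd ℂ) (Ψ x) := by
      apply integral_congr_ae
      filter_upwards [h2.coeFn_toLp] with x hx
      rw [hx]; simp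
    have e2 : ∫ a, inner ℂ ((𝓕⁻ (h2.toLp Ψ) : Lp ℂ 2 (volume : Measure ℝ)) a)
        ((hf.toLp f) a) = innerL2 f (𝓕⁻ Ψ) := by
      apply integral_congr_ae
      filter_upwards [hf.coeFn_toLp, coeFn_fourierInv_toLp_ae_eq h1 h2] with x hx hx2
      rw [hx, hx2]; simp
    rw [← e2, ← h, e1]

theorem memLp_fourierInv {Ψ : ℝ → ℂ} (h1 : Integrable Ψ) (h2 : MemLp Ψ 2 volume) :
    MemLp (𝓕⁻ Ψ) 2 volume :=
  (memLp_congr_ae (coeFn_fourierInv_toLp_ae_eq h1 h2)).1 (Lp.memLp _)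

/-! ### Exponential weights on `ℤ` -/

/-- The weight `e^{-ρ|k|}` on `ℤ`, with values in `[0, ∞]`. -/
noncomputable def expWeight (ρ : ℝ) (k : ℤ) : ℝ≥0∞ := ENNReal.ofReal (Real.exp (-ρ * |(k : ℝ)|))

theorem summable_exp_neg_mul_abs_int {ρ : ℝ} (hρ : 0 < ρ) :
    Summable (fun k : ℤ => Real.exp (-ρ * |(k : ℝ)|)) := by
  have h : Summable (fun n : ℕ => Real.exp (-ρ * (n : ℝ))) := by
    have := Real.summable_exp_nat_mul_iff.2 (neg_lt_zero.2 hρ)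
    simpa [mul_comm] using this
  refine Summable.of_nat_of_neg ?_ ?_ <;> simpa using h

theorem tsum_expWeight_ne_top {ρ : ℝ} (hρ : 0 < ρ) : ∑' k, expWeight ρ k ≠ ∞ := by
  unfold expWeight
  rw [← ENNReal.ofReal_tsum_of_nonneg (fun _ => (Real.exp_pos _).le)
    (summable_exp_neg_mul_abs_int hρ)]
  exact ENNReal.ofReal_ne_top

theorem tsum_expWeight_sub (ρ : ℝ) (l : ℤ) : ∑' k, expWeight ρ (k - l) = ∑' k, expWeight ρ k :=
  (Equiv.subRight l).tsum_eq (expWeight ρ)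

theorem tsum_expWeight_sub_left (ρ : ℝ) (l : ℤ) :
    ∑' k, expWeight ρ (l - k) = ∑' k, expWeight ρ k :=
  (Equiv.subLeft l).tsum_eq (expWeight ρ)

theorem expWeight_half_sq (ρ : ℝ) (k : ℤ) : expWeight (ρ / 2) k ^ 2 = expWeight ρ k := by
  unfold expWeight
  rw [← ENNReal.ofReal_pow (Real.exp_pos _).le, ← Real.exp_nat_mul]
  congr 2; push_cast; ring

theorem tsum_mul_sq_le {ι : Type*} (a b : ι → ℝ≥0∞) :
    (∑' i, a i * b i) ^ 2 ≤ (∑' i, a i ^ 2) * ∑' i, b i ^ 2 := by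
  let _ : MeasurableSpace ι := ⊤
  have h := ENNReal.lintegral_mul_le_Lp_mul_Lq (Measure.count : Measure ι)
    Real.HolderConjugate.two_two (f := a) (g := b) measurable_from_top.aemeasurable
    measurable_from_top.aemeasurable
  have : MeasurableSingletonClass ι := ⟨fun _ => trivial⟩
  simp only [lintegral_count, Pi.mul_apply] at h
  calc _ ≤ ((∑' i, a i ^ (2 : ℝ)) ^ (1 / (2 : ℝ)) * (∑' i, b i ^ (2 : ℝ)) ^ (1 / (2 : ℝ))) ^ 2 := by
        gcongr
    _ = _ := by
        rw [mul_pow, ← ENNReal.rpow_natCast, ← ENNReal.rpow_natCast, ← ENNReal.rpow_mul,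
          ← ENNReal.rpow_mul]
        simp

theorem enorm_tsum_mul_sq_le {C ρ : ℝ} (c ψ : ℤ → ℂ) (l : ℤ)
    (hψ : ∀ k, ‖ψ k‖ ≤ C * Real.exp (-ρ * |((k - l : ℤ) : ℝ)|)) :
    ‖∑' k, c k * ψ k‖ₑ ^ 2 ≤
      ENNReal.ofReal C ^ 2 * (∑' k, expWeight ρ k) * ∑' k, expWeight ρ (k - l) * ‖c k‖ₑ ^ 2 := by
  have hC : 0 ≤ C := by
    have := (norm_nonneg _).trans (hψ l)
    simpa using this
  have hψ' : ∀ k, ‖ψ k‖ₑ ≤ ENNReal.ofReal C * expWeight ρ (k - l) := by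
    intro k
    rw [← ofReal_norm, expWeight, ← ENNReal.ofReal_mul hC]
    exact ENNReal.ofReal_le_ofReal (hψ k)
  calc ‖∑' k, c k * ψ k‖ₑ ^ 2
      ≤ (∑' k, (‖c k‖ₑ * expWeight (ρ / 2) (k - l)) *
          (ENNReal.ofReal C * expWeight (ρ / 2) (k - l))) ^ 2 := by
        gcongr
        refine enorm_tsum_le_tsum_enorm.trans (ENNReal.tsum_le_tsum fun k => ?_)
        rw [enorm_mul]
        calc _ ≤ ‖c k‖ₑ * (ENNReal.ofReal C * expWeight ρ (k - l)) := by gcongr; exact hψ' k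
          _ = _ := by rw [← expWeight_half_sq]; ring
    _ ≤ _ := tsum_mul_sq_le _ _
    _ = _ := by
        simp only [mul_pow, expWeight_half_sq, ENNReal.tsum_mul_left, tsum_expWeight_sub]
        rw [mul_comm]
        simp only [mul_comm]

/-! ### Periodization and Parseval's identity -/

theorem lintegral_eq_setLIntegral_tsum {H : ℝ → ℝ≥0∞} (hH : AEMeasurable H volume) :
    ∫⁻ x, H x = ∫⁻ x in Set.Ioc (0 : ℝ) 1, ∑' k : ℤ, H (x + k) := by
  rw [lintegral_tsum]
  · rw [← setLIntegral_univ, ← iUnion_Ioc_intCast (α := ℝ),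
      lintegral_iUnion (fun _ => measurableSet_Ioc) (Set.pairwise_disjoint_Ioc_intCast ℝ)]
    congr 1; ext k
    rw [← lintegral_indicator measurableSet_Ioc, ← lintegral_indicator measurableSet_Ioc,
      ← lintegral_add_right_eq_self ((Set.Ioc (k : ℝ) (k + 1)).indicator H) (k : ℝ)]
    congr 1; ext x
    simp only [Set.indicator, Set.mem_Ioc]
    have : ((k : ℝ) < x + k ∧ x + k ≤ k + 1) ↔ (0 < x ∧ x ≤ 1) := by
      constructor <;> rintro ⟨h1, h2⟩ <;> constructor <;> linarith
    simp only [this]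
  · intro k
    exact (hH.comp_quasiMeasurePreserving
      (measurePreserving_add_right volume (k : ℝ)).quasiMeasurePreserving).restrict

theorem ae_summable_norm_comp_add_int {H : ℝ → ℂ} (hH : Integrable H) :
    ∀ᵐ x ∂(volume.restrict (Set.Ioc (0 : ℝ) 1)), Summable fun k : ℤ => ‖H (x + k)‖ := by
  have h := hH.2
  rw [HasFiniteIntegral, lintegral_eq_setLIntegral_tsum hH.1.enorm] at h
  have hm : AEMeasurable (fun x : ℝ => ∑' k : ℤ, ‖H (x + k)‖ₑ)
      (volume.restrict (Set.Ioc (0 : ℝ) 1)) := by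
    refine AEMeasurable.tsum fun k => ?_
    exact (hH.1.enorm.comp_quasiMeasurePreserving
      (measurePreserving_add_right volume (k : ℝ)).quasiMeasurePreserving).restrict
  filter_upwards [ae_lt_top' hm h.ne] with x hx
  have : Summable fun k : ℤ => ‖H (x + k)‖₊ := by
    rw [← ENNReal.tsum_coe_ne_top_iff_summable]
    exact hx.ne
  exact NNReal.summable_coe.2 this

theorem aestronglyMeasurable_periodization {H : ℝ → ℂ} (hH : Integrable H) :
    AEStronglyMeasurable (fun x : ℝ => ∑' k : ℤ, H (x + k))
      (volume.restrict (Set.Ioc (0 : ℝ) 1)) := by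
  refine aestronglyMeasurable_of_tendsto_ae (u := (atTop : Filter (Finset ℤ)))
    (f := fun s x => ∑ k ∈ s, H (x + k)) ?_ ?_
  · intro s
    refine Finset.aestronglyMeasurable_fun_sum _ fun k _ => ?_
    exact (hH.1.comp_quasiMeasurePreserving
      (measurePreserving_add_right volume (k : ℝ)).quasiMeasurePreserving).restrict
  · filter_upwards [ae_summable_norm_comp_add_int hH] with x hx
    exact hx.of_norm.hasSum

theorem integral_eq_setIntegral_tsum {H : ℝ → ℂ} (hH : Integrable H) :
    ∫ x, H x = ∫ x in Set.Ioc (0 : ℝ) 1, ∑' k : ℤ, H (x + k) := by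
  have hshift : ∀ k : ℤ, ∫ x in Set.Ioc (0 : ℝ) 1, H (x + k) =
      ∫ x in Set.Ioc (k : ℝ) (k + 1), H x := by
    intro k
    rw [← integral_indicator measurableSet_Ioc, ← integral_indicator measurableSet_Ioc,
      ← integral_add_right_eq_self ((Set.Ioc (k : ℝ) (k + 1)).indicator H) (k : ℝ)]
    refine congrArg _ (funext fun x => ?_)
    simp only [Set.indicator, Set.mem_Ioc]
    have : ((k : ℝ) < x + k ∧ x + k ≤ k + 1) ↔ (0 < x ∧ x ≤ 1) := by
      constructor <;> rintro ⟨h1, h2⟩ <;> constructor <;> linarith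
    simp only [this]
  rw [← setIntegral_univ, ← iUnion_Ioc_intCast (α := ℝ),
    integral_iUnion (fun _ => measurableSet_Ioc) (Set.pairwise_disjoint_Ioc_intCast ℝ)
      (by exact hH.integrableOn)]
  simp only [← hshift]
  rw [integral_tsum]
  · intro k
    exact (hH.1.comp_quasiMeasurePreserving
      (measurePreserving_add_right volume (k : ℝ)).quasiMeasurePreserving).restrict
  · rw [← lintegral_tsum, ← lintegral_eq_setLIntegral_tsum hH.1.enorm]
    · exact hH.2.ne
    · intro k
      exact (hH.1.enorm.comp_quasiMeasurePreserving
        (measurePreserving_add_right volume (k : ℝ)).quasiMeasurePreserving).restrict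

/-- Parseval's identity for the periodization of an integrable function: its Fourier coefficients
are the values of the Fourier integral at the integers. -/
theorem tsum_enorm_sq_integral_mul_exp {H : ℝ → ℂ} (hH : Integrable H)
    (h2 : MemLp (fun x : ℝ => ∑' k : ℤ, H (x + k)) 2 (volume.restrict (Set.Ioc (0 : ℝ) 1))) :
    ∑' n : ℤ, ‖∫ x, H x * Complex.exp (2 * Real.pi * Complex.I * n * x)‖ₑ ^ 2 =
      ∫⁻ x in Set.Ioc (0 : ℝ) 1, ‖∑' k : ℤ, H (x + k)‖ₑ ^ 2 := by
  have hP := hasSum_sq_fourierCoeffOn (zero_lt_one' ℝ) h2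
  have hcoef : ∀ n : ℤ, fourierCoeffOn (zero_lt_one' ℝ) (fun x : ℝ => ∑' k : ℤ, H (x + k)) (-n) =
      ∫ x, H x * Complex.exp (2 * Real.pi * Complex.I * n * x) := by
    intro n
    rw [fourierCoeffOn_eq_integral, integral_eq_setIntegral_tsum,
      intervalIntegral.integral_of_le zero_le_one]
    · simp only [sub_zero, div_one, one_smul, neg_neg, smul_eq_mul]
      refine setIntegral_congr_fun measurableSet_Ioc fun x _ => ?_
      rw [← tsum_mul_left]
      congr 1; ext k
      rw [mul_comm (H _)]
      congr 1
      rw [fourier_coe_apply, Complex.exp_eq_exp_iff_exists_int]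
      refine ⟨-(n * k), ?_⟩
      push_cast
      ring
    · refine hH.mul_bdd (c := 1) ?_ ?_
      · exact (by fun_prop : Continuous fun x : ℝ =>
          Complex.exp (2 * Real.pi * Complex.I * n * x)).aestronglyMeasurable
      · refine Eventually.of_forall fun x => ?_
        rw [Complex.norm_exp]
        simp
  have hneg := (Equiv.neg ℤ).hasSum_iff.2 hP
  simp only [Function.comp_def, Equiv.neg_apply, hcoef, sub_zero, inv_one, one_smul] at hneg
  have e1 : ∑' n : ℤ, ‖∫ x, H x * Complex.exp (2 * Real.pi * Complex.I * n * x)‖ₑ ^ 2 =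
      ENNReal.ofReal (∫ x in (0 : ℝ)..1, ‖∑' k : ℤ, H (x + k)‖ ^ 2) := by
    rw [← hneg.tsum_eq, ENNReal.ofReal_tsum_of_nonneg (fun _ => by positivity) hneg.summable]
    congr 1; ext n
    rw [ENNReal.ofReal_pow (norm_nonneg _), ofReal_norm]
  rw [e1, intervalIntegral.integral_of_le zero_le_one,
    ofReal_integral_eq_lintegral_ofReal]
  · congr 1; ext x
    rw [ENNReal.ofReal_pow (norm_nonneg _), ofReal_norm]
  · exact (memLp_two_iff_integrable_sq_norm h2.1).1 h2
  · exact Eventually.of_forall fun x => by positivity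

/-! ### The frame coefficients on the Fourier side -/

theorem exp_neg_mul_abs_add_le {ρ : ℝ} (hρ : 0 ≤ ρ) {s : ℝ} (hs : |s| ≤ 1) (k : ℝ) :
    Real.exp (-ρ * |s + k|) ≤ Real.exp ρ * Real.exp (-ρ * |k|) := by
  rw [← Real.exp_add]
  apply Real.exp_le_exp.2
  have : |k| ≤ |s + k| + |s| := by
    have := abs_sub (s + k) s
    simpa using this
  nlinarith

theorem integrable_exp_neg_mul_abs {ρ : ℝ} (hρ : 0 < ρ) :
    Integrable (fun x : ℝ => Real.exp (-ρ * |x|)) := by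
  have h2 : IntegrableOn (fun x : ℝ => Real.exp (-ρ * |x|)) (Set.Ioi 0) := by
    refine (integrableOn_congr_fun (fun x (hx : 0 < x) => ?_) measurableSet_Ioi).2
      (exp_neg_integrableOn_Ioi 0 hρ)
    simp only [abs_of_pos hx]
  have h3 : IntegrableOn (fun x : ℝ => Real.exp (-ρ * |x|)) (Set.Iic 0) := by
    refine (integrableOn_congr_fun (fun x (hx : x ≤ 0) => ?_) measurableSet_Iic).2
      (integrableOn_exp_mul_Iic hρ 0)
    simp only [abs_of_nonpos hx, neg_mul_neg]
  rw [← integrableOn_univ, ← Set.Iic_union_Ioi (a := (0 : ℝ))]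
  exact h3.union h2

/-- Exponential decay at rate `ρ`, with constant `C`. -/
def ExpDecay (C ρ : ℝ) (φ : ℝ → ℂ) : Prop :=
  ∀ x, ‖φ x‖ ≤ C * Real.exp (-ρ * |x|)

namespace ExpDecay

variable {C ρ : ℝ} {φ : ℝ → ℂ}

theorem integrable (h : ExpDecay C ρ φ) (hρ : 0 < ρ) (hm : Measurable φ) : Integrable φ :=
  ((integrable_exp_neg_mul_abs hρ).const_mul C).mono' hm.aestronglyMeasurable
    (Eventually.of_forall h)

theorem memLp_two (h : ExpDecay C ρ φ) (hρ : 0 < ρ) (hm : Measurable φ) : MemLp φ 2 volume := by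
  refine (memLp_two_iff_integrable_sq_norm hm.aestronglyMeasurable).2 ?_
  refine ((integrable_exp_neg_mul_abs (mul_pos two_pos hρ)).const_mul (C ^ 2)).mono'
    (by fun_prop) (Eventually.of_forall fun x => ?_)
  rw [Real.norm_of_nonneg (by positivity)]
  calc ‖φ x‖ ^ 2 ≤ (C * Real.exp (-ρ * |x|)) ^ 2 := by gcongr; exact h x
    _ = _ := by rw [mul_pow, ← Real.exp_nat_mul]; congr 2; push_cast; ring

theorem norm_le_int (h : ExpDecay C ρ φ) (hρ : 0 < ρ) {s : ℝ} (hs : |s| ≤ 1) (k : ℤ) :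
    ‖φ (s + k)‖ ≤ C * Real.exp ρ * Real.exp (-ρ * |(k : ℝ)|) := by
  have hC : 0 ≤ C := by
    have := (norm_nonneg _).trans (h 0)
    simpa using this
  refine (h _).trans ?_
  rw [mul_assoc]
  exact mul_le_mul_of_nonneg_left (exp_neg_mul_abs_add_le hρ.le hs k) hC

end ExpDecay

theorem timeFreqShift_fourierInv (φ : ℝ → ℂ) (lam mu : ℝ) :
    timeFreqShift lam mu (𝓕⁻ φ) =
      𝓕⁻ (fun ξ => Complex.exp (-(2 * Real.pi * Complex.I * mu * (ξ - lam : ℝ))) *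
        φ (ξ - lam)) := by
  ext t
  rw [timeFreqShift, Real.fourierInv_eq', Real.fourierInv_eq']
  conv_rhs => rw [← integral_add_right_eq_self _ lam]
  rw [← integral_const_mul]
  congr 1; ext ξ
  simp only [smul_eq_mul, RCLike.inner_apply, conj_trivial]
  rw [add_sub_cancel_right, ← mul_assoc (Complex.exp _) (Complex.exp _),
    ← mul_assoc (Complex.exp _) (Complex.exp _), ← Complex.exp_add, ← Complex.exp_add]
  congr 2
  push_cast
  ring

theorem memLp_comp_sub_right {φ : ℝ → ℂ} (h : MemLp φ 2 volume) (lam : ℝ) :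
    MemLp (fun ξ => φ (ξ - lam)) 2 volume := by
  exact h.comp_measurePreserving (measurePreserving_sub_right volume lam)

theorem integrable_mul_conj_shift {φ F : ℝ → ℂ} (hφ : MemLp φ 2 volume) (hF : MemLp F 2 volume)
    (lam : ℝ) : Integrable fun ξ => F ξ * (starRingEnd ℂ) (φ (ξ - lam)) := by
  exact hF.integrable_mul (memLp_comp_sub_right hφ lam).star

theorem memLp_periodization_mul_conj {C ρ : ℝ} {φ F : ℝ → ℂ} (hφ : ExpDecay C ρ φ) (hρ : 0 < ρ)
    (hm : Measurable φ) (hF : MemLp F 2 volume) (lam : ℝ) :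
    MemLp (fun x : ℝ => ∑' k : ℤ, F (x + k) * (starRingEnd ℂ) (φ (x + k - lam))) 2
      (volume.restrict (Set.Ioc (0 : ℝ) 1)) := by
  have hint := integrable_mul_conj_shift (hφ.memLp_two hρ hm) hF lam
  refine ⟨aestronglyMeasurable_periodization hint, ?_⟩
  rw [eLpNorm_lt_top_iff_lintegral_rpow_enorm_lt_top (by norm_num) (by norm_num)]
  simp only [ENNReal.toReal_ofNat, ENNReal.rpow_ofNat]
  set D : ℝ≥0∞ := ENNReal.ofReal (C * Real.exp ρ) ^ 2 * (∑' k, expWeight ρ k) with hD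
  have hbound : ∀ x ∈ Set.Ioc (0 : ℝ) 1,
      ‖∑' k : ℤ, F (x + k) * (starRingEnd ℂ) (φ (x + k - lam))‖ₑ ^ 2 ≤
        D * ∑' k : ℤ, ‖F (x + k)‖ₑ ^ 2 := by
    intro x hx
    refine (enorm_tsum_mul_sq_le (C := C * Real.exp ρ) (ρ := ρ) _ _ ⌊lam⌋ fun k => ?_).trans ?_
    · have h1 : |x - lam + ⌊lam⌋| ≤ 1 := by
        rw [abs_le]
        have := Int.floor_le lam
        have := Int.lt_floor_add_one lam
        constructor <;> linarith [hx.1, hx.2]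
      have := hφ.norm_le_int hρ h1 (k - ⌊lam⌋)
      rw [RCLike.norm_conj]
      rwa [show x - lam + ⌊lam⌋ + ((k - ⌊lam⌋ : ℤ) : ℝ) = x + k - lam by push_cast; ring] at this
    · gcongr with k
      refine (mul_le_of_le_one_left zero_le ?_)
      rw [expWeight, ENNReal.ofReal_le_one]
      apply Real.exp_le_one_iff.2
      have := abs_nonneg ((k - ⌊lam⌋ : ℤ) : ℝ)
      nlinarith
  calc _ ≤ ∫⁻ x in Set.Ioc (0 : ℝ) 1, D * ∑' k : ℤ, ‖F (x + k)‖ₑ ^ 2 :=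
        setLIntegral_mono' measurableSet_Ioc hbound
    _ = D * ∫⁻ x, ‖F x‖ₑ ^ 2 := by
        rw [lintegral_const_mul', lintegral_eq_setLIntegral_tsum (hF.1.enorm.pow_const 2)]
        exact ENNReal.mul_ne_top (by finiteness) (tsum_expWeight_ne_top hρ)
    _ < ∞ := by
        refine ENNReal.mul_lt_top (ENNReal.mul_lt_top (by finiteness)
          (tsum_expWeight_ne_top hρ).lt_top) ?_
        have := hF.2
        rw [eLpNorm_lt_top_iff_lintegral_rpow_enorm_lt_top (by norm_num) (by norm_num)] at this
        simpa using this

/-- For a window `𝓕⁻ φ` and integer time shifts, the frame coefficients of a fixed frequency are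
the Fourier coefficients of a periodization on the Fourier side. -/
theorem tsum_enorm_sq_innerL2 {C ρ : ℝ} {φ f F : ℝ → ℂ} (hφ : ExpDecay C ρ φ) (hρ : 0 < ρ)
    (hm : Measurable φ) (hF : MemLp F 2 volume)
    (hfF : ∀ Ψ : ℝ → ℂ, Integrable Ψ → MemLp Ψ 2 volume →
        innerL2 f (𝓕⁻ Ψ) = ∫ x, F x * (starRingEnd ℂ) (Ψ x)) (lam : ℝ) :
    ∑' n : ℤ, ‖innerL2 f (timeFreqShift lam n (𝓕⁻ φ))‖ₑ ^ 2 =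
      ∫⁻ x in Set.Ioc (0 : ℝ) 1,
        ‖∑' k : ℤ, F (x + k) * (starRingEnd ℂ) (φ (x + k - lam))‖ₑ ^ 2 := by
  have hint := integrable_mul_conj_shift (hφ.memLp_two hρ hm) hF lam
  rw [← tsum_enorm_sq_integral_mul_exp hint (memLp_periodization_mul_conj hφ hρ hm hF lam)]
  congr 1; ext n
  have hnorm : ∀ ξ : ℝ, ‖Complex.exp (-(2 * Real.pi * Complex.I * n * (ξ - lam : ℝ)))‖ = 1 := by
    intro ξ
    rw [Complex.norm_exp]
    simp
  have hae : AEStronglyMeasurable (fun ξ : ℝ =>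
      Complex.exp (-(2 * Real.pi * Complex.I * n * (ξ - lam : ℝ))) * φ (ξ - lam)) volume := by
    fun_prop
  have h2 := memLp_comp_sub_right (hφ.memLp_two hρ hm) lam
  have h1 := (hφ.integrable hρ hm).comp_sub_right lam
  rw [timeFreqShift_fourierInv, hfF]
  · have : ∀ x : ℝ, F x * (starRingEnd ℂ)
        (Complex.exp (-(2 * Real.pi * Complex.I * (n : ℝ) * (x - lam : ℝ))) * φ (x - lam)) =
        Complex.exp (-(2 * Real.pi * Complex.I * n * lam)) *
        (F x * (starRingEnd ℂ) (φ (x - lam)) *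
          Complex.exp (2 * Real.pi * Complex.I * n * x)) := by
      intro x
      have : (starRingEnd ℂ) (Complex.exp (-(2 * Real.pi * Complex.I * (n : ℝ) * (x - lam : ℝ))))
          = Complex.exp (-(2 * Real.pi * Complex.I * n * lam)) *
            Complex.exp (2 * Real.pi * Complex.I * n * x) := by
        rw [← Complex.exp_conj, ← Complex.exp_add]
        congr 1
        simp only [map_neg, map_mul, Complex.conj_ofReal, Complex.conj_I, map_ofNat]
        push_cast
        ring
      rw [map_mul, this]
      ring
    simp only [this, integral_const_mul, enorm_mul]
    have h0 := hnorm (lam + lam)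
    have : ‖Complex.exp (-(2 * Real.pi * Complex.I * n * lam))‖ₑ = 1 := by
      rw [← ofReal_norm]
      rw [show ((lam + lam - lam : ℝ) : ℂ) = lam by push_cast; ring] at h0
      rw [h0]; simp
    rw [this, one_mul]
  · exact h1.mono (by exact_mod_cast hae) (Eventually.of_forall fun ξ => by
      have := hnorm ξ
      rw [norm_mul]
      push_cast at this ⊢
      rw [this, one_mul])
  · exact h2.mono (by exact_mod_cast hae) (Eventually.of_forall fun ξ => by
      have := hnorm ξ
      rw [norm_mul]
      push_cast at this ⊢
      rw [this, one_mul])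

/-! ### Linear recurrences on `ℤ` -/

/-- The shift `(S v)_k = v_{k+1}` on two-sided sequences. -/
noncomputable def seqShift : Module.End ℂ (ℤ → ℂ) := LinearMap.funLeft ℂ ℂ (· + 1)

@[simp] theorem seqShift_apply (v : ℤ → ℂ) (k : ℤ) : seqShift v k = v (k + 1) := rfl

theorem seqShift_pow_apply (n : ℕ) (v : ℤ → ℂ) (k : ℤ) : (seqShift ^ n) v k = v (k + n) := by
  induction n generalizing v k with
  | zero => simp
  | succ n ih =>
    rw [pow_succ, Module.End.mul_apply, ih, seqShift_apply]
    congr 1; push_cast; ring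

theorem aeval_seqShift_apply {p : Polynomial ℂ} {n : ℕ} (hn : p.natDegree < n) (v : ℤ → ℂ)
    (k : ℤ) : Polynomial.aeval seqShift p v k = ∑ i ∈ Finset.range n, p.coeff i * v (k + i) := by
  rw [Polynomial.aeval_eq_sum_range' hn, LinearMap.sum_apply, Finset.sum_apply]
  refine Finset.sum_congr rfl fun i _ => ?_
  rw [LinearMap.smul_apply, Pi.smul_apply, seqShift_pow_apply, smul_eq_mul]

theorem forward_zero_of_recurrence {M : ℕ} {r : ℕ → ℂ} (hr : ∃ j < M, r j ≠ 0) {G : ℤ → ℂ}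
    (hG : ∀ m : ℤ, ∑ j ∈ Finset.range M, r j * G (j + m) = 0) {s : ℤ}
    (hs : ∀ i < M, G (s + i) = 0) (n : ℕ) : G (s + n) = 0 := by
  classical
  -- the last nonzero coefficient determines each entry from the preceding ones
  obtain ⟨j, hjM, hj, hmax⟩ : ∃ j < M, r j ≠ 0 ∧ ∀ i < M, j < i → r i = 0 := by
    obtain ⟨j0, h0, h1⟩ := hr
    set T := (Finset.range M).filter fun j => r j ≠ 0
    have hT : T.Nonempty := ⟨j0, by simp [T, h0, h1]⟩
    have hm := T.max'_mem hT
    simp only [T, Finset.mem_filter, Finset.mem_range] at hm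
    refine ⟨T.max' hT, hm.1, hm.2, fun i hi hlt => ?_⟩
    by_contra hne
    exact absurd (T.le_max' i (by simp [T, hi, hne])) (not_le.2 hlt)
  induction n using Nat.strong_induction_on with
  | _ n ih =>
    by_cases hn : n < M
    · exact hs n hn
    · have h := hG (s + n - j)
      rw [Finset.sum_eq_single_of_mem j (Finset.mem_range.2 hjM)] at h
      · rcases mul_eq_zero.1 h with h | h
        · exact absurd h hj
        · rwa [show (j : ℤ) + (s + n - j) = s + n by ring] at h
      · intro i hi hne
        rw [Finset.mem_range] at hi
        rcases lt_or_gt_of_ne hne with hlt | hgt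
        · have := ih (n + i - j) (by omega)
          rw [show (i : ℤ) + (s + n - j) = s + (n + i - j : ℕ) by
            rw [Nat.cast_sub (by omega)]; push_cast; ring, this, mul_zero]
        · rw [hmax i hi hgt, zero_mul]

/-- A solution of a nontrivial recurrence involving `M` consecutive entries vanishes as soon as it
vanishes at `M` consecutive places. -/
theorem eq_zero_of_recurrence {M : ℕ} {r : ℕ → ℂ} (hr : ∃ j < M, r j ≠ 0) {G : ℤ → ℂ}
    (hG : ∀ m : ℤ, ∑ j ∈ Finset.range M, r j * G (j + m) = 0) {s : ℤ}
    (hs : ∀ i < M, G (s + i) = 0) : G = 0 := by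
  ext k
  rcases le_total s k with h | h
  · have := forward_zero_of_recurrence hr hG hs (k - s).toNat
    rwa [Int.toNat_of_nonneg (by omega), show s + (k - s) = k by ring] at this
  · obtain ⟨j0, h0, h1⟩ := hr
    have := forward_zero_of_recurrence (M := M) (r := fun j => r (M - 1 - j))
      (G := fun k => G (-k)) (s := -(s + (M - 1 : ℕ)))
      ⟨M - 1 - j0, by omega, by
        rwa [show M - 1 - (M - 1 - j0) = j0 by omega]⟩
      (fun m => by
        rw [← Finset.sum_range_reflect]
        rw [← hG (-(m + (M - 1 : ℕ)))]
        refine Finset.sum_congr rfl fun j hj => ?_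
        rw [Finset.mem_range] at hj
        rw [show M - 1 - (M - 1 - j) = j by omega, Nat.cast_sub (by omega : j ≤ M - 1)]
        congr 2; ring)
      (fun i hi => by
        rw [← hs (M - 1 - i) (by omega), Nat.cast_sub (by omega : i ≤ M - 1)]
        congr 1; ring) (s + (M - 1 : ℕ) - k).toNat
    rw [Int.toNat_of_nonneg (by omega)] at this
    rw [show -(-(s + ((M - 1 : ℕ) : ℤ)) + (s + (M - 1 : ℕ) - k)) = k by ring] at this
    exact this

/-! ### Exponential polynomials on `ℤ` -/

/-- The sequence `k ↦ ζ^k Q(k)`. -/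
noncomputable def expPolySeq (ζ : ℂ) (Q : Polynomial ℂ) (k : ℤ) : ℂ := ζ ^ k * Q.eval (k : ℂ)

theorem seqShift_sub_pow_expPolySeq {ζ : ℂ} (hζ : ζ ≠ 0) (j : ℕ) {Q : Polynomial ℂ}
    (hQ : Q.degree < j) :
    ((seqShift - algebraMap ℂ (Module.End ℂ (ℤ → ℂ)) ζ) ^ j) (expPolySeq ζ Q) = 0 := by
  induction j generalizing Q with
  | zero =>
    have : Q = 0 := by simpa using hQ
    ext k
    simp [this, expPolySeq]
  | succ j ih =>
    have h1 : (seqShift - algebraMap ℂ (Module.End ℂ (ℤ → ℂ)) ζ) (expPolySeq ζ Q) =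
        ζ • expPolySeq ζ (Polynomial.taylor 1 Q - Q) := by
      ext k
      simp only [expPolySeq, LinearMap.sub_apply, Pi.sub_apply, seqShift_apply,
        Module.algebraMap_end_apply, Pi.smul_apply, smul_eq_mul, Polynomial.eval_sub,
        Polynomial.taylor_eval, zpow_add_one₀ hζ]
      push_cast
      ring
    rw [pow_succ, Module.End.mul_apply, h1, map_smul, ih, smul_zero]
    by_cases h0 : Q = 0
    · simp [h0]
    · have h2 : (Polynomial.taylor 1 Q - Q).degree < (Polynomial.taylor 1 Q).degree :=
        Polynomial.degree_sub_lt_left (Polynomial.degree_taylor _ _)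
          (by rwa [Ne, Polynomial.taylor_eq_zero]) (Polynomial.leadingCoeff_taylor _ _)
      rw [Polynomial.degree_taylor] at h2
      rw [Polynomial.degree_eq_natDegree h0] at hQ h2
      refine h2.trans_le ?_
      have : Q.natDegree < j + 1 := by exact_mod_cast hQ
      exact_mod_cast Nat.lt_succ_iff.1 this

theorem expPolySeq_mem_maxGenEigenspace {ζ : ℂ} (hζ : ζ ≠ 0) (Q : Polynomial ℂ) :
    expPolySeq ζ Q ∈ seqShift.maxGenEigenspace ζ := by
  rw [Module.End.mem_maxGenEigenspace]
  exact ⟨Q.natDegree + 1, by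
    have := seqShift_sub_pow_expPolySeq hζ (Q.natDegree + 1) (Q := Q)
      (Q.degree_le_natDegree.trans_lt (by exact_mod_cast Nat.lt_succ_self _))
    rwa [Algebra.algebraMap_eq_smul_one] at this⟩

theorem eq_zero_of_expPolySeq_eq_zero {ζ : ℂ} (hζ : ζ ≠ 0) {Q : Polynomial ℂ}
    (h : expPolySeq ζ Q = 0) : Q = 0 := by
  refine Polynomial.eq_zero_of_infinite_isRoot Q
    (Set.Infinite.mono (s := Set.range fun k : ℤ => (k : ℂ)) ?_
      (Set.infinite_range_of_injective Int.cast_injective))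
  rintro _ ⟨k, rfl⟩
  have := congrFun h k
  simpa [expPolySeq, zpow_ne_zero k hζ] using this

/-- Linear independence of exponential polynomials: if `∑ᵢ ζᵢ^k Qᵢ(k) = 0` for all integers `k`,
then the polynomials belonging to the same `ζ` add up to zero. -/
theorem sum_expPoly_eq_zero {ι : Type*} [Fintype ι] {ζ : ι → ℂ} (hζ : ∀ i, ζ i ≠ 0)
    {Q : ι → Polynomial ℂ} (h : ∀ k : ℤ, ∑ i, ζ i ^ k * (Q i).eval (k : ℂ) = 0)
    (χ : ℂ → ℂ) (s : ℂ) : ∑ i, χ (ζ i) * (Q i).eval s = 0 := by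
  classical
  set T := Finset.univ.image ζ with hT
  set R : ℂ → Polynomial ℂ := fun z => ∑ i with ζ i = z, Q i with hR
  have hmaps : ∀ i ∈ (Finset.univ : Finset ι), ζ i ∈ T := fun i _ =>
    Finset.mem_image_of_mem _ (Finset.mem_univ i)
  have hsum : ∀ (χ : ℂ → ℂ) (s : ℂ), ∑ i, χ (ζ i) * (Q i).eval s =
      ∑ z ∈ T, χ z * (R z).eval s := by
    intro χ s
    rw [← Finset.sum_fiberwise_of_maps_to hmaps]
    refine Finset.sum_congr rfl fun z _ => ?_
    rw [hR, Polynomial.eval_finsetSum, Finset.mul_sum]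
    refine Finset.sum_congr rfl fun i hi => ?_
    rw [(Finset.mem_filter.1 hi).2]
  have hR0 : ∀ z ∈ T, R z = 0 := by
    have hind := seqShift.independent_maxGenEigenspace
    rw [iSupIndep_iff_finsetSum_eq_zero_imp_eq_zero] at hind
    have hne : ∀ z ∈ T, z ≠ 0 := by
      intro z hz
      obtain ⟨i, -, rfl⟩ := Finset.mem_image.1 hz
      exact hζ i
    have h0 : ∑ z ∈ T, expPolySeq z (R z) = 0 := by
      ext k
      rw [Finset.sum_apply]
      exact (hsum (fun z => z ^ k) k).symm.trans (h k)
    intro z hz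
    exact eq_zero_of_expPolySeq_eq_zero (hne z hz) (hind T (fun z => expPolySeq z (R z))
      (fun z hz => expPolySeq_mem_maxGenEigenspace (hne z hz) _) h0 z hz)
  rw [hsum, Finset.sum_eq_zero fun z hz => by rw [hR0 z hz, Polynomial.eval_zero, mul_zero]]

/-! ### Injectivity on bounded sequences -/

theorem eq_zero_of_seqShift_sub_eq_zero {ζ : ℂ} (h0 : ζ ≠ 0) (h1 : ‖ζ‖ ≠ 1) {v : ℤ → ℂ} {B : ℝ}
    (hB : ∀ k, ‖v k‖ ≤ B)
    (h : (seqShift - algebraMap ℂ (Module.End ℂ (ℤ → ℂ)) ζ) v = 0) : v = 0 := by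
  have hstep : ∀ k, v (k + 1) = ζ * v k := by
    intro k
    have := congrFun h k
    simpa [sub_eq_zero] using this
  ext k
  by_contra hk
  have hk' : 0 < ‖v k‖ := norm_pos_iff.2 hk
  rcases lt_or_gt_of_ne h1 with hlt | hgt
  · have hn : ∀ n : ℕ, ‖v k‖ = ‖ζ‖ ^ n * ‖v (k - n)‖ := by
      intro n
      induction n with
      | zero => simp
      | succ n ih =>
        rw [ih, show k - (n : ℤ) = (k - (n + 1 : ℕ)) + 1 by push_cast; ring, hstep, norm_mul]
        ring
    have hlim : Tendsto (fun n : ℕ => ‖ζ‖ ^ n * B) atTop (𝓝 (0 * B)) :=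
      (tendsto_pow_atTop_nhds_zero_of_lt_one (norm_nonneg _) hlt).mul_const B
    rw [zero_mul] at hlim
    refine absurd (ge_of_tendsto' hlim (b := ‖v k‖) fun n => ?_) (not_le.2 hk')
    rw [hn n]
    gcongr
    exact hB _
  · have hn : ∀ n : ℕ, ‖v (k + n)‖ = ‖ζ‖ ^ n * ‖v k‖ := by
      intro n
      induction n with
      | zero => simp
      | succ n ih =>
        rw [show k + ((n + 1 : ℕ) : ℤ) = (k + n) + 1 by push_cast; ring, hstep, norm_mul, ih]
        ring
    have hlim : Tendsto (fun n : ℕ => ‖ζ‖ ^ n * ‖v k‖) atTop atTop :=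
      (tendsto_pow_atTop_atTop_of_one_lt hgt).atTop_mul_const hk'
    obtain ⟨n, hn'⟩ := (hlim.eventually_gt_atTop B).exists
    rw [← hn n] at hn'
    exact absurd (hB _) (not_le.2 hn')

theorem bounded_seqShift_sub (ζ : ℂ) {v : ℤ → ℂ} (hv : ∃ B : ℝ, ∀ k, ‖v k‖ ≤ B) :
    ∃ B : ℝ, ∀ k, ‖(seqShift - algebraMap ℂ (Module.End ℂ (ℤ → ℂ)) ζ) v k‖ ≤ B := by
  obtain ⟨B, hB⟩ := hv
  refine ⟨B + ‖ζ‖ * B, fun k => ?_⟩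
  have : (seqShift - algebraMap ℂ (Module.End ℂ (ℤ → ℂ)) ζ) v k = v (k + 1) - ζ * v k := by
    simp
  rw [this]
  refine (norm_sub_le _ _).trans (add_le_add (hB _) ?_)
  rw [norm_mul]
  gcongr
  exact hB _

/-- A polynomial in the shift without zeros on the unit circle is injective on bounded
sequences. -/
theorem eq_zero_of_aeval_seqShift_eq_zero (s : Multiset ℂ) (h0 : ∀ ζ ∈ s, ζ ≠ 0)
    (h1 : ∀ ζ ∈ s, ‖ζ‖ ≠ 1) {v : ℤ → ℂ} (hv : ∃ B : ℝ, ∀ k, ‖v k‖ ≤ B)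
    (h : Polynomial.aeval seqShift (s.map fun ζ => Polynomial.X - Polynomial.C ζ).prod v = 0) :
    v = 0 := by
  induction s using Multiset.induction_on generalizing v with
  | empty => simpa using h
  | cons ζ s ih =>
    rw [Multiset.map_cons, Multiset.prod_cons, mul_comm, map_mul, Module.End.mul_apply] at h
    have h2 := ih (fun z hz => h0 z (Multiset.mem_cons_of_mem hz))
      (fun z hz => h1 z (Multiset.mem_cons_of_mem hz)) (by
        rw [map_sub, Polynomial.aeval_X, Polynomial.aeval_C]
        exact bounded_seqShift_sub ζ hv) h
    rw [map_sub, Polynomial.aeval_X, Polynomial.aeval_C] at h2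
    obtain ⟨B, hB⟩ := hv
    exact eq_zero_of_seqShift_sub_eq_zero (h0 ζ (Multiset.mem_cons_self _ _))
      (h1 ζ (Multiset.mem_cons_self _ _)) hB h2

/-! ### Pairs of decaying exponential polynomials and uniqueness -/

/-- Two entire functions `P` and `N`, decaying exponentially at rate `ρ` towards `+∞` and `-∞`
respectively, whose integer samples solve a common recurrence of order `M` with no characteristic
root on the unit circle, and such that gluing `P` (right of `0`) to `N` (left of `0`) gives a
function that does not vanish on any translate of `ℤ`. -/
structure IsDecayPair (M : ℕ) (ρ : ℝ) (P N : ℂ → ℂ) : Prop where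
  rate_pos : 0 < ρ
  differentiable_right : Differentiable ℂ P
  differentiable_left : Differentiable ℂ N
  decay_right : ∀ R : ℝ, ∃ C : ℝ, ∀ z : ℂ, |z.im| ≤ R → -R ≤ z.re →
    ‖P z‖ ≤ C * Real.exp (-ρ * |z.re|)
  decay_left : ∀ R : ℝ, ∃ C : ℝ, ∀ z : ℂ, |z.im| ≤ R → z.re ≤ R →
    ‖N z‖ ≤ C * Real.exp (-ρ * |z.re|)
  exists_roots : ∃ s : Multiset ℂ, s.card = M ∧ (∀ ζ ∈ s, ζ ≠ 0) ∧ (∀ ζ ∈ s, ‖ζ‖ ≠ 1) ∧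
    (∀ z : ℂ, Polynomial.aeval seqShift (s.map fun ζ => Polynomial.X - Polynomial.C ζ).prod
      (fun k : ℤ => P (z + k)) = 0) ∧
    (∀ z : ℂ, Polynomial.aeval seqShift (s.map fun ζ => Polynomial.X - Polynomial.C ζ).prod
      (fun k : ℤ => N (z + k)) = 0)
  exists_ne_zero : ∀ y ∈ Set.Icc (0 : ℝ) 1,
    (∃ k : ℤ, 0 ≤ k ∧ P (y + k) ≠ 0) ∨ (∃ k : ℤ, k < 0 ∧ N (y + k) ≠ 0)

/-- The function equal to `P` on `(0, ∞)` and to `N` on `(-∞, 0]`. -/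
noncomputable def glue (P N : ℂ → ℂ) (x : ℝ) : ℂ := if 0 < x then P x else N x

theorem exists_expDecay_glue {ρ : ℝ} {P N : ℂ → ℂ}
    (hP : ∀ R : ℝ, ∃ C : ℝ, ∀ z : ℂ, |z.im| ≤ R → -R ≤ z.re →
      ‖P z‖ ≤ C * Real.exp (-ρ * |z.re|))
    (hN : ∀ R : ℝ, ∃ C : ℝ, ∀ z : ℂ, |z.im| ≤ R → z.re ≤ R →
      ‖N z‖ ≤ C * Real.exp (-ρ * |z.re|)) : ∃ C, ExpDecay C ρ (glue P N) := by
  obtain ⟨C1, h1⟩ := hP 0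
  obtain ⟨C2, h2⟩ := hN 0
  refine ⟨max C1 C2, fun x => ?_⟩
  unfold glue
  split_ifs with hx
  · refine (h1 x (by simp) (by simpa using hx.le)).trans ?_
    rw [Complex.ofReal_re]
    gcongr
    exact le_max_left _ _
  · refine (h2 x (by simp) (by simpa using hx)).trans ?_
    rw [Complex.ofReal_re]
    gcongr
    exact le_max_right _ _

theorem measurable_glue {P N : ℂ → ℂ} (hP : Continuous P) (hN : Continuous N) :
    Measurable (glue P N) :=
  Measurable.ite measurableSet_Ioi (by fun_prop) (by fun_prop)

/-- The samples `k ↦ φ(y + k)` of a glued function, with the one-sided limits at the jump when `y`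
is `0` (limit from the right) or `1` (limit from the left). -/
noncomputable def glueSeq (P N : ℂ → ℂ) (y : ℝ) (k : ℤ) : ℂ :=
  if 0 ≤ k then P (y + k) else N (y + k)

namespace IsDecayPair

variable {M : ℕ} {ρ : ℝ} {P N : ℂ → ℂ}

theorem measurable_glue (h : IsDecayPair M ρ P N) : Measurable (glue P N) :=
  _root_.measurable_glue h.differentiable_right.continuous h.differentiable_left.continuous

theorem exists_decay_glue (h : IsDecayPair M ρ P N) : ∃ C, ExpDecay C ρ (glue P N) :=
  exists_expDecay_glue h.decay_right h.decay_left

theorem exists_decay_glueSeq (h : IsDecayPair M ρ P N) {y : ℝ} (hy : y ∈ Set.Icc (0 : ℝ) 1) :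
    ∃ C : ℝ, ∀ k : ℤ, ‖glueSeq P N y k‖ ≤ C * Real.exp (-ρ * |(k : ℝ)|) := by
  obtain ⟨C1, h1⟩ := h.decay_right 0
  obtain ⟨C2, h2⟩ := h.decay_left 0
  have hC1 : 0 ≤ C1 := by simpa using (norm_nonneg _).trans (h1 0 (by simp) (by simp))
  have hC2 : 0 ≤ C2 := by simpa using (norm_nonneg _).trans (h2 0 (by simp) (by simp))
  have hy1 : |y| ≤ 1 := by rw [abs_le]; constructor <;> linarith [hy.1, hy.2]
  refine ⟨max C1 C2 * Real.exp ρ, fun k => ?_⟩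
  have hk := exp_neg_mul_abs_add_le h.rate_pos.le hy1 k
  have key : ∀ C : ℝ, 0 ≤ C → C ≤ max C1 C2 → C * Real.exp (-ρ * |y + k|) ≤
      max C1 C2 * Real.exp ρ * Real.exp (-ρ * |(k : ℝ)|) := by
    intro C hC hle
    rw [mul_assoc]
    exact mul_le_mul hle hk (Real.exp_pos _).le (hC.trans hle)
  unfold glueSeq
  split_ifs with hx
  · have hx' : (0 : ℝ) ≤ k := by exact_mod_cast hx
    have := h1 (y + k) (by simp) (by simpa using by linarith [hy.1])
    simp only [Complex.add_re, Complex.ofReal_re, Complex.intCast_re] at this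
    exact this.trans (key _ hC1 (le_max_left _ _))
  · have hx' : (k : ℝ) ≤ -1 := by exact_mod_cast (by omega : k ≤ -1)
    have := h2 (y + k) (by simp) (by simpa using by linarith [hy.2])
    simp only [Complex.add_re, Complex.ofReal_re, Complex.intCast_re] at this
    exact this.trans (key _ hC2 (le_max_right _ _))

/-- The two branches of a decay pair are different functions: otherwise their samples would be
a bounded solution of the recurrence, hence zero. -/
theorem exists_sub_ne_zero (h : IsDecayPair M ρ P N) : ∃ z, P z - N z ≠ 0 := by
  by_contra! hcon
  obtain ⟨s, -, hs0, hs1, hsP, -⟩ := h.exists_roots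
  have h0 : (fun k : ℤ => P ((0 : ℝ) + k)) = 0 := by
    refine eq_zero_of_aeval_seqShift_eq_zero s hs0 hs1 ?_ (hsP _)
    obtain ⟨C, hC⟩ := h.exists_decay_glueSeq (y := 0) (by simp)
    refine ⟨max C 0, fun k => ?_⟩
    have h1 := hC k
    have h2 : glueSeq P N 0 k = P ((0 : ℝ) + k) := by
      unfold glueSeq
      split_ifs
      · rfl
      · exact (sub_eq_zero.1 (hcon _)).symm
    rw [h2] at h1
    refine h1.trans ?_
    have h3 : Real.exp (-ρ * |(k : ℝ)|) ≤ 1 := Real.exp_le_one_iff.2 (by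
      have := h.rate_pos
      have := abs_nonneg (k : ℝ)
      nlinarith)
    calc _ ≤ max C 0 * Real.exp (-ρ * |(k : ℝ)|) := by gcongr; exact le_max_left _ _
      _ ≤ max C 0 * 1 := by gcongr
      _ = _ := mul_one _
  rcases h.exists_ne_zero 0 (by simp) with ⟨k, -, hk⟩ | ⟨k, -, hk⟩
  · exact hk (congrFun h0 k)
  · refine hk ?_
    rw [← sub_eq_zero.1 (hcon _)]
    exact congrFun h0 k

/-- The recurrence annihilating the branches turns the samples of a decay pair into a nonzero
sequence supported on `M` consecutive integers. -/
theorem exists_annihilator (h : IsDecayPair M ρ P N) {y : ℝ} (hy : y ∈ Set.Icc (0 : ℝ) 1) :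
    ∃ (q r : ℕ → ℂ), (∃ j < M, r j ≠ 0) ∧
      (∀ k : ℤ, (∀ j < M, k ≠ j - M) →
        ∑ i ∈ Finset.range (M + 1), q i * glueSeq P N y (k + i) = 0) ∧
      ∀ j < M, ∑ i ∈ Finset.range (M + 1), q i * glueSeq P N y ((j : ℤ) - M + i) = r j := by
  obtain ⟨s, hsM, hs0, hs1, hsP, hsN⟩ := h.exists_roots
  set p := (s.map fun ζ => Polynomial.X - Polynomial.C ζ).prod with hp
  have hdeg : p.natDegree < M + 1 := by
    rw [hp, Polynomial.natDegree_multiset_prod_X_sub_C_eq_card, hsM]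
    exact Nat.lt_succ_self M
  have hzero : ∀ k : ℤ, (∀ j < M, k ≠ (j : ℕ) - M) →
      ∑ i ∈ Finset.range (M + 1), p.coeff i * glueSeq P N y (k + i) = 0 := by
    intro k hk
    rcases lt_or_ge k 0 with hneg | hpos
    · have hk' : k + M < 0 := by
        by_contra hge
        exact hk (k + M).toNat (by omega) (by omega)
      have := congrFun (hsN y) k
      rw [aeval_seqShift_apply hdeg] at this
      refine Eq.trans (Finset.sum_congr rfl fun i hi => ?_) this
      rw [Finset.mem_range] at hi
      rw [glueSeq, if_neg (by omega)]
    · have := congrFun (hsP y) k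
      rw [aeval_seqShift_apply hdeg] at this
      refine Eq.trans (Finset.sum_congr rfl fun i hi => ?_) this
      rw [glueSeq, if_pos (by omega)]
  refine ⟨p.coeff, fun j => ∑ i ∈ Finset.range (M + 1), p.coeff i *
    glueSeq P N y ((j : ℤ) - M + i), ?_, hzero, fun j _ => rfl⟩
  by_contra! hcon
  have h0 : glueSeq P N y = 0 := by
    refine eq_zero_of_aeval_seqShift_eq_zero s hs0 hs1 ?_ ?_
    · obtain ⟨C, hC⟩ := h.exists_decay_glueSeq hy
      have hC0 : 0 ≤ C := by simpa using (norm_nonneg _).trans (hC 0)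
      refine ⟨C, fun k => (hC k).trans ?_⟩
      refine mul_le_of_le_one_right hC0 (Real.exp_le_one_iff.2 ?_)
      have := h.rate_pos
      have := abs_nonneg (k : ℝ)
      nlinarith
    · ext k
      rw [← hp, aeval_seqShift_apply hdeg]
      by_cases hk : ∀ j < M, k ≠ (j : ℕ) - M
      · exact hzero k hk
      · push Not at hk
        obtain ⟨j, hj, rfl⟩ := hk
        exact hcon j hj
  rcases h.exists_ne_zero y hy with ⟨k, hk0, hk⟩ | ⟨k, hk0, hk⟩
  · have := congrFun h0 k
    rw [glueSeq, if_pos hk0] at this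
    exact hk this
  · have := congrFun h0 k
    rw [glueSeq, if_neg (by omega)] at this
    exact hk this

end IsDecayPair

/-- Subexponential growth against exponential decay gives summability. -/
theorem summable_mul_of_growth_of_decay {c v : ℤ → ℂ} {D C δ ρ : ℝ} (hδ : δ < ρ)
    (hc : ∀ k, ‖c k‖ ≤ D * Real.exp (δ * |(k : ℝ)|))
    (hv : ∀ k, ‖v k‖ ≤ C * Real.exp (-ρ * |(k : ℝ)|)) : Summable fun k => c k * v k := by
  refine Summable.of_norm_bounded
    ((summable_exp_neg_mul_abs_int (sub_pos.2 hδ)).mul_left (D * C)) fun k => ?_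
  rw [norm_mul]
  have hD : 0 ≤ D * Real.exp (δ * |(k : ℝ)|) := (norm_nonneg _).trans (hc k)
  calc _ ≤ (D * Real.exp (δ * |(k : ℝ)|)) * (C * Real.exp (-ρ * |(k : ℝ)|)) :=
        mul_le_mul (hc k) (hv k) (norm_nonneg _) hD
    _ = D * C * (Real.exp (δ * |(k : ℝ)|) * Real.exp (-ρ * |(k : ℝ)|)) := by ring
    _ = _ := by rw [← Real.exp_add]; congr 2; ring

theorem growth_comp_add {c : ℤ → ℂ} {D δ : ℝ} (hδ : 0 ≤ δ)
    (hc : ∀ k, ‖c k‖ ≤ D * Real.exp (δ * |(k : ℝ)|)) (m : ℤ) :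
    ∀ k, ‖c (k + m)‖ ≤ D * Real.exp (δ * |(m : ℝ)|) * Real.exp (δ * |(k : ℝ)|) := by
  intro k
  have hD : 0 ≤ D := by simpa using (norm_nonneg _).trans (hc 0)
  refine (hc _).trans ?_
  rw [mul_assoc, ← Real.exp_add]
  refine mul_le_mul_of_nonneg_left (Real.exp_le_exp.2 ?_) hD
  have := abs_add_le (k : ℝ) m
  push_cast
  nlinarith

theorem ExpDecay.comp_add_int {C ρ : ℝ} {φ : ℝ → ℂ} (h : ExpDecay C ρ φ) (hρ : 0 < ρ) (y : ℝ) :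
    ∀ k : ℤ, ‖φ (y + k)‖ ≤ C * Real.exp (ρ * |y|) * Real.exp (-ρ * |(k : ℝ)|) := by
  intro k
  have hC : 0 ≤ C := by simpa using (norm_nonneg _).trans (h 0)
  refine (h _).trans ?_
  rw [mul_assoc, ← Real.exp_add]
  refine mul_le_mul_of_nonneg_left (Real.exp_le_exp.2 ?_) hC
  have : |(k : ℝ)| ≤ |y + k| + |y| := by
    have := abs_sub (y + k) y
    simpa using this
  nlinarith

/-- On `(m, m + 1)` the function `y ↦ ∑ₖ cₖ φ(y + k)`, for `φ` glued from `P` and `N`, is the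
restriction of this entire function. -/
noncomputable def branchSum (P N : ℂ → ℂ) (c : ℤ → ℂ) (m : ℤ) (z : ℂ) : ℂ :=
  ∑' k : ℤ, c k * (if -m ≤ k then P (z + k) else N (z + k))

theorem branchSum_ofReal {P N : ℂ → ℂ} (c : ℤ → ℂ) {m : ℤ} {y : ℝ} (h0 : 0 < y) (h1 : y < 1) :
    branchSum P N c m ((y + m : ℝ) : ℂ) = ∑' k : ℤ, c k * glue P N (y + m + k) := by
  refine tsum_congr fun k => ?_
  unfold glue
  have : (0 < y + m + k) ↔ -m ≤ k := by
    constructor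
    · intro h
      by_contra hlt
      have : (m : ℝ) + k ≤ -1 := by exact_mod_cast (by omega : m + k ≤ -1)
      linarith
    · intro h
      have : (0 : ℝ) ≤ m + k := by exact_mod_cast (by omega : 0 ≤ m + k)
      linarith
  simp only [this]
  push_cast
  rfl

namespace IsDecayPair

variable {M : ℕ} {ρ : ℝ} {P N : ℂ → ℂ}

theorem exists_bound_branch (h : IsDecayPair M ρ P N) (m : ℤ) (R : ℝ) :
    ∃ C : ℝ, ∀ z : ℂ, ‖z‖ ≤ R → ∀ k : ℤ,
      ‖if -m ≤ k then P (z + k) else N (z + k)‖ ≤ C * Real.exp (-ρ * |(k : ℝ)|) := by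
  obtain ⟨C1, h1⟩ := h.decay_right (|R| + |(m : ℝ)|)
  obtain ⟨C2, h2⟩ := h.decay_left (|R| + |(m : ℝ)|)
  have hC1 : 0 ≤ C1 := by
    simpa using (norm_nonneg _).trans (h1 0 (by simp; positivity) (by
      rw [Complex.zero_re]; linarith [abs_nonneg R, abs_nonneg (m : ℝ)]))
  have hC2 : 0 ≤ C2 := by
    simpa using (norm_nonneg _).trans (h2 0 (by simp; positivity) (by simp; positivity))
  refine ⟨max C1 C2 * Real.exp (ρ * |R|), fun z hz k => ?_⟩
  have him := z.abs_im_le_norm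
  have hre := z.abs_re_le_norm
  have hR := le_abs_self R
  have hm := abs_nonneg (m : ℝ)
  have key : ∀ C : ℝ, 0 ≤ C → C ≤ max C1 C2 → C * Real.exp (-ρ * |(z + k).re|) ≤
      max C1 C2 * Real.exp (ρ * |R|) * Real.exp (-ρ * |(k : ℝ)|) := by
    intro C hC hle
    rw [mul_assoc, ← Real.exp_add]
    refine mul_le_mul hle (Real.exp_le_exp.2 ?_) (Real.exp_pos _).le (hC.trans hle)
    have h3 : |(k : ℝ)| ≤ |z.re + k| + |z.re| := by
      have := abs_sub (z.re + k) z.re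
      simpa using this
    have h4 := h.rate_pos
    simp only [Complex.add_re, Complex.intCast_re]
    nlinarith
  have hz' := abs_le.1 (hre.trans hz)
  split_ifs with hk
  · refine (h1 _ ?_ ?_).trans (key _ hC1 (le_max_left _ _))
    · simp only [Complex.add_im, Complex.intCast_im, add_zero]; linarith
    · have : -(m : ℝ) ≤ k := by exact_mod_cast hk
      have := le_abs_self (m : ℝ)
      simp only [Complex.add_re, Complex.intCast_re]; linarith
  · refine (h2 _ ?_ ?_).trans (key _ hC2 (le_max_right _ _))
    · simp only [Complex.add_im, Complex.intCast_im, add_zero]; linarith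
    · have : (k : ℝ) ≤ -m := by exact_mod_cast (by omega : k ≤ -m)
      have := neg_abs_le (m : ℝ)
      simp only [Complex.add_re, Complex.intCast_re]; linarith

variable {c : ℤ → ℂ} {D δ : ℝ}

theorem summable_branch (h : IsDecayPair M ρ P N) (hδ : δ < ρ)
    (hc : ∀ k, ‖c k‖ ≤ D * Real.exp (δ * |(k : ℝ)|)) (m : ℤ) (z : ℂ) :
    Summable fun k : ℤ => c k * (if -m ≤ k then P (z + k) else N (z + k)) := by
  obtain ⟨C, hC⟩ := h.exists_bound_branch m ‖z‖
  exact summable_mul_of_growth_of_decay hδ hc (hC z le_rfl)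

theorem differentiable_branchSum (h : IsDecayPair M ρ P N) (hδ : δ < ρ)
    (hc : ∀ k, ‖c k‖ ≤ D * Real.exp (δ * |(k : ℝ)|)) (m : ℤ) :
    Differentiable ℂ (branchSum P N c m) := by
  intro z
  obtain ⟨C, hC⟩ := h.exists_bound_branch m (‖z‖ + 1)
  refine DifferentiableOn.differentiableAt (s := Metric.ball 0 (‖z‖ + 1)) ?_
    (Metric.isOpen_ball.mem_nhds (by simp))
  refine Complex.differentiableOn_tsum_of_summable_norm
    (u := fun k : ℤ => D * C * Real.exp (-(ρ - δ) * |(k : ℝ)|))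
    ((summable_exp_neg_mul_abs_int (sub_pos.2 hδ)).mul_left (D * C)) ?_ Metric.isOpen_ball ?_
  · intro k
    have hP := h.differentiable_right
    have hN := h.differentiable_left
    split_ifs
    · exact (by fun_prop : Differentiable ℂ fun w => c k * P (w + k)).differentiableOn
    · exact (by fun_prop : Differentiable ℂ fun w => c k * N (w + k)).differentiableOn
  · intro k w hw
    have hw' : ‖w‖ ≤ ‖z‖ + 1 := by simpa using (mem_ball_zero_iff.1 hw).le
    rw [norm_mul]
    calc _ ≤ (D * Real.exp (δ * |(k : ℝ)|)) * (C * Real.exp (-ρ * |(k : ℝ)|)) :=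
          mul_le_mul (hc k) (hC w hw' k) (norm_nonneg _) ((norm_nonneg _).trans (hc k))
      _ = D * C * (Real.exp (δ * |(k : ℝ)|) * Real.exp (-ρ * |(k : ℝ)|)) := by ring
      _ = _ := by rw [← Real.exp_add]; congr 2; ring

/-- A sequence is determined by the function `∑ₖ cₖ φ(y + k)`, because `c₋ₘ` is the factor by which
this function jumps at `m` along `P - N`. -/
theorem eq_zero_of_branchSum_eq_zero (h : IsDecayPair M ρ P N) (hδ : δ < ρ)
    (hc : ∀ k, ‖c k‖ ≤ D * Real.exp (δ * |(k : ℝ)|))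
    (h0 : ∀ m z, branchSum P N c m z = 0) : c = 0 := by
  obtain ⟨z0, hz0⟩ := h.exists_sub_ne_zero
  ext m
  have e := sub_eq_zero.2 ((h0 (-m) (z0 - m)).trans (h0 (-m - 1) (z0 - m)).symm)
  unfold branchSum at e
  rw [← (h.summable_branch hδ hc _ _).tsum_sub (h.summable_branch hδ hc _ _),
    tsum_eq_single m] at e
  · rw [if_pos (by omega), if_neg (by omega), ← mul_sub, sub_add_cancel] at e
    exact (mul_eq_zero.1 e).resolve_right hz0
  · intro k hk
    by_cases hlt : m < k
    · rw [if_pos (by omega), if_pos (by omega), sub_self]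
    · rw [if_neg (by omega), if_neg (by omega), sub_self]

/-- If the convolution of `c` with the samples of `φ` at `ξ + ℤ` vanishes, then `c` solves a
nontrivial recurrence, and so does `m ↦ ∑ₖ cₖ φ(y + k - m)` for every `y`; the latter therefore
vanishes as soon as it does so at `M` consecutive places. -/
theorem tsum_glue_eq_zero (h : IsDecayPair M ρ P N) (hδ0 : 0 ≤ δ) (hδ : δ < ρ)
    (hc : ∀ k, ‖c k‖ ≤ D * Real.exp (δ * |(k : ℝ)|)) {ξ : ℝ} (hξ : ξ ∈ Set.Icc (0 : ℝ) 1)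
    (H1 : ∀ l : ℤ, ∑' k : ℤ, c k * glueSeq P N ξ (k - l) = 0) {y : ℝ} {s : ℤ}
    (H2 : ∀ i < M, ∑' k : ℤ, c k * glue P N (y + ((k - (s + i) : ℤ) : ℝ)) = 0) (m : ℤ) :
    ∑' k : ℤ, c k * glue P N (y + ((k - m : ℤ) : ℝ)) = 0 := by
  obtain ⟨q, r, hr, hq0, hqr⟩ := h.exists_annihilator hξ
  obtain ⟨Cu, hu⟩ := h.exists_decay_glueSeq hξ
  obtain ⟨Cφ, hφ⟩ := h.exists_decay_glue
  have hcomp : ∀ (v : ℤ → ℂ) (l : ℤ), ∑' k, c k * v (k - l) = ∑' k, c (k + l) * v k := by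
    intro v l
    rw [← (Equiv.addRight l).tsum_eq (fun k => c k * v (k - l))]
    simp
  have hrec : ∀ l : ℤ, ∑ j ∈ Finset.range M, r j * c (j + l) = 0 := by
    intro l
    have e1 : ∑' k : ℤ, c (k + (l + M)) *
        ∑ i ∈ Finset.range (M + 1), q i * glueSeq P N ξ (k + i) = 0 := by
      have hsum : ∀ i ∈ Finset.range (M + 1), Summable fun k : ℤ =>
          q i * (c (k + (l + M)) * glueSeq P N ξ (k + i)) := by
        intro i _
        refine Summable.mul_left _ ?_
        have := summable_mul_of_growth_of_decay hδ (growth_comp_add hδ0 hc (l + M - i)) hu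
        refine ((Equiv.addRight (i : ℤ)).summable_iff.2 this).congr fun k => ?_
        simp only [Function.comp_apply, Equiv.coe_addRight]
        rw [show k + (i : ℤ) + (l + M - i) = k + (l + M) by ring]
      have : ∀ k : ℤ, c (k + (l + M)) *
          ∑ i ∈ Finset.range (M + 1), q i * glueSeq P N ξ (k + i) =
          ∑ i ∈ Finset.range (M + 1), q i * (c (k + (l + M)) * glueSeq P N ξ (k + i)) := by
        intro k
        rw [Finset.mul_sum]
        refine Finset.sum_congr rfl fun i _ => by ring
      simp only [this]
      rw [Summable.tsum_finsetSum hsum]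
      refine Finset.sum_eq_zero fun i _ => ?_
      rw [tsum_mul_left]
      have h3 := H1 (l + M - i)
      rw [← (Equiv.addRight (l + M : ℤ)).tsum_eq] at h3
      simp only [Equiv.coe_addRight] at h3
      rw [← mul_zero (q i), ← h3]
      congr 1
      refine tsum_congr fun k => ?_
      congr 2; ring
    rw [tsum_eq_sum (s := (Finset.range M).image fun j : ℕ => (j : ℤ) - M)] at e1
    · rw [Finset.sum_image (fun a _ b _ hab => by simpa using hab)] at e1
      rw [← e1]
      refine Finset.sum_congr rfl fun j hj => ?_
      rw [hqr j (Finset.mem_range.1 hj), mul_comm]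
      congr 2; ring
    · intro k hk
      rw [hq0 k (fun j hj hkj => hk (Finset.mem_image.2 ⟨j, Finset.mem_range.2 hj, hkj.symm⟩)),
        mul_zero]
  set G : ℤ → ℂ := fun m => ∑' k : ℤ, c k * glue P N (y + ((k - m : ℤ) : ℝ)) with hG
  have hG' : ∀ m, G m = ∑' k : ℤ, c (k + m) * glue P N (y + (k : ℝ)) := fun m =>
    hcomp (fun k => glue P N (y + (k : ℝ))) m
  have hsumm : ∀ m, Summable fun k : ℤ => c (k + m) * glue P N (y + (k : ℝ)) := fun m =>
    summable_mul_of_growth_of_decay hδ (growth_comp_add hδ0 hc m)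
      (hφ.comp_add_int h.rate_pos y)
  have : G = 0 := by
    refine eq_zero_of_recurrence hr (s := s) (fun m => ?_) (fun i hi => H2 i hi)
    simp only [hG', ← tsum_mul_left]
    rw [← Summable.tsum_finsetSum (fun j _ => (hsumm _).mul_left _), ← tsum_zero]
    refine tsum_congr fun k => ?_
    have := hrec (k + m)
    calc _ = (∑ j ∈ Finset.range M, r j * c (j + (k + m))) * glue P N (y + (k : ℝ)) := by
          rw [Finset.sum_mul]
          refine Finset.sum_congr rfl fun j _ => ?_
          rw [show (j : ℤ) + (k + m) = k + (j + m) by ring]; ring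
      _ = 0 := by rw [this, zero_mul]
  exact congrFun this m

/-- Uniqueness for sequences of small exponential growth: the equations along `ξ + ℤ`, together with
`M` consecutive equations along `ξ - xₙ + ℤ` for infinitely many shifts `xₙ → 0`, force `c = 0`. -/
theorem eq_zero_of_equations (h : IsDecayPair M ρ P N) (hδ0 : 0 ≤ δ) (hδ : δ < ρ)
    (hc : ∀ k, ‖c k‖ ≤ D * Real.exp (δ * |(k : ℝ)|)) {ξ : ℝ} (hξ : ξ ∈ Set.Icc (0 : ℝ) 1)
    (H1 : ∀ l : ℤ, ∑' k : ℤ, c k * glueSeq P N ξ (k - l) = 0) {x : ℕ → ℝ}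
    (hx0 : ∀ n, 0 < x n) (hx : Tendsto x atTop (𝓝 0))
    (H2 : ∀ n, x n ≠ ξ → ∃ s : ℤ, ∀ i < M,
      ∑' k : ℤ, c k * glue P N (ξ - x n + ((k - (s + i) : ℤ) : ℝ)) = 0) : c = 0 := by
  -- the shifts approach a point of `(0, 1]` strictly from the left
  obtain ⟨t, ht⟩ : ∃ t : ℤ, ξ + t ∈ Set.Ioc (0 : ℝ) 1 := by
    rcases hξ.1.eq_or_lt with h0 | h0
    · exact ⟨1, by simp [← h0]⟩
    · exact ⟨0, by simpa using ⟨h0, hξ.2⟩⟩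
  refine h.eq_zero_of_branchSum_eq_zero hδ hc fun m => ?_
  have han : AnalyticOnNhd ℂ (branchSum P N c m) Set.univ := by
    intro z _
    exact (h.differentiable_branchSum hδ hc m).analyticAt z
  have hfreq : ∃ᶠ z in 𝓝[≠] ((ξ + t + m : ℝ) : ℂ), branchSum P N c m z = 0 := by
    have hlim : Tendsto (fun n => ((ξ + t + m - x n : ℝ) : ℂ)) atTop
        (𝓝[≠] ((ξ + t + m : ℝ) : ℂ)) := by
      refine tendsto_nhdsWithin_iff.2 ⟨?_, Eventually.of_forall fun n => ?_⟩
      · have := (tendsto_const_nhds (x := ξ + t + m)).sub hx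
        rw [sub_zero] at this
        exact (Complex.continuous_ofReal.tendsto _).comp this
      · simp only [Set.mem_compl_iff, Set.mem_singleton_iff, Complex.ofReal_inj]
        linarith [hx0 n]
    refine hlim.frequently (Eventually.frequently ?_)
    have hsmall : ∀ᶠ n in atTop, x n < ξ + t := hx.eventually_lt_const ht.1
    have hne : ∀ᶠ n in atTop, x n ≠ ξ := by
      rcases hξ.1.eq_or_lt with h0 | h0
      · exact Eventually.of_forall fun n => by rw [← h0]; exact (hx0 n).ne'
      · exact (hx.eventually_lt_const h0).mono fun n hn => hn.ne
    filter_upwards [hsmall, hne] with n hn1 hn2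
    obtain ⟨s, hs⟩ := H2 n hn2
    have := h.tsum_glue_eq_zero hδ0 hδ hc hξ H1 hs (-(t + m))
    rw [show (ξ + t + m - x n : ℝ) = (ξ + t - x n) + m by ring,
      branchSum_ofReal c (by linarith) (by linarith [hx0 n, ht.2]), ← this]
    refine tsum_congr fun k => ?_
    congr 2
    push_cast; ring
  intro z
  exact han.eqOn_zero_of_preconnected_of_frequently_eq_zero isPreconnected_univ
    (Set.mem_univ _) hfreq (Set.mem_univ z)

end IsDecayPair

/-! ### Compactness: a uniform local estimate -/

/-- The correlation `∑ₖ cₖ φ(y + k - l)` of a sequence with the samples of `φ`. -/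
noncomputable def sampleSum (φ : ℝ → ℂ) (c : ℤ → ℂ) (y : ℝ) (l : ℤ) : ℂ :=
  ∑' k : ℤ, c k * φ (y + ((k - l : ℤ) : ℝ))

theorem sampleSum_shift_smul (φ : ℝ → ℂ) (c : ℤ → ℂ) (y : ℝ) (l m : ℤ) (a : ℂ) :
    sampleSum φ (fun k => a * c (k + m)) y l = a * sampleSum φ c y (l + m) := by
  unfold sampleSum
  rw [← tsum_mul_left, ← (Equiv.addRight m).tsum_eq (fun k => a * (c k * φ _))]
  refine tsum_congr fun k => ?_
  rw [Equiv.coe_addRight, mul_assoc, show k + m - (l + m) = k - l by ring]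

/-- The extra frequencies `l + θ l`, `l ∈ E`, contain, for each shift `x n`, blocks of `M`
consecutive integers with fractional part `x n` within bounded distance of every integer. -/
structure IsBlockPattern (M : ℕ) (E : Set ℤ) (θ : ℤ → ℝ) (x : ℕ → ℝ) : Prop where
  shift_mem : ∀ l, θ l ∈ Set.Ioo (0 : ℝ) 1
  mem : ∀ n, x n ∈ Set.Ioo (0 : ℝ) 1
  tendsto : Tendsto x atTop (𝓝 0)
  exists_block : ∀ n, ∃ R : ℕ, ∀ m : ℤ, ∃ s : ℤ, |s| ≤ R ∧
    ∀ i < M, s + i + m ∈ E ∧ θ (s + i + m) = x n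

/-- The squared moduli of the two equations attached to the integer `l`: along `ξ + ℤ`, and, if
`l ∈ E`, along `ξ - θ l + ℤ`. -/
noncomputable def localEnergy (φ : ℝ → ℂ) (E : Set ℤ) (θ : ℤ → ℝ) (c : ℤ → ℂ) (ξ : ℝ) (l : ℤ) :
    ℝ≥0∞ :=
  ‖sampleSum φ c ξ l‖ₑ ^ 2 + E.indicator (fun l => ‖sampleSum φ c (ξ - θ l) l‖ₑ ^ 2) l

theorem enorm_sq_le_of_mul_expWeight_le {ρ : ℝ} {k : ℤ} {a : ℂ} {B : ℝ} (hB : 0 ≤ B)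
    (h : expWeight ρ k * ‖a‖ₑ ^ 2 ≤ ENNReal.ofReal B) :
    ‖a‖ ≤ Real.sqrt B * Real.exp (ρ / 2 * |(k : ℝ)|) := by
  rw [expWeight, ← ofReal_norm, ← ENNReal.ofReal_pow (norm_nonneg _),
    ← ENNReal.ofReal_mul (Real.exp_pos _).le, ENNReal.ofReal_le_ofReal_iff hB] at h
  refine abs_le_of_sq_le_sq' ?_ (by positivity) |>.2
  rw [mul_pow, Real.sq_sqrt hB, ← Real.exp_nat_mul]
  have h2 : ‖a‖ ^ 2 = Real.exp (ρ * |(k : ℝ)|) * (Real.exp (-ρ * |(k : ℝ)|) * ‖a‖ ^ 2) := by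
    rw [← mul_assoc, ← Real.exp_add]; simp
  rw [h2, mul_comm B]
  refine (mul_le_mul_of_nonneg_left h (Real.exp_pos _).le).trans (le_of_eq ?_)
  congr 2; push_cast; ring

namespace IsDecayPair

variable {M : ℕ} {ρ : ℝ} {P N : ℂ → ℂ}

theorem glue_add_int_eq_glueSeq {ξ : ℝ} (hξ : ξ ∈ Set.Ioo (0 : ℝ) 1) (k : ℤ) :
    glue P N (ξ + (k : ℝ)) = glueSeq P N ξ k := by
  unfold glue glueSeq
  have : (0 < ξ + (k : ℝ)) ↔ 0 ≤ k := by
    constructor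
    · intro h
      by_contra hlt
      have : (k : ℝ) ≤ -1 := by exact_mod_cast (by omega : k ≤ -1)
      linarith [hξ.2]
    · intro h
      have : (0 : ℝ) ≤ k := by exact_mod_cast h
      linarith [hξ.1]
  simp only [this]
  push_cast
  rfl

theorem continuous_glueSeq (h : IsDecayPair M ρ P N) (k : ℤ) :
    Continuous fun y => glueSeq P N y k := by
  have hP := h.differentiable_right.continuous
  have hN := h.differentiable_left.continuous
  unfold glueSeq
  split_ifs <;> fun_prop

theorem continuousAt_glue (h : IsDecayPair M ρ P N) {y : ℝ} (hy : y ≠ 0) :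
    ContinuousAt (glue P N) y := by
  have hP := h.differentiable_right.continuous
  have hN := h.differentiable_left.continuous
  rcases lt_or_gt_of_ne hy with h0 | h0
  · refine ((by fun_prop : Continuous fun x : ℝ => N x).continuousAt).congr ?_
    filter_upwards [Iio_mem_nhds h0] with x hx
    rw [glue, if_neg (not_lt.2 (le_of_lt hx))]
  · refine ((by fun_prop : Continuous fun x : ℝ => P x).continuousAt).congr ?_
    filter_upwards [Ioi_mem_nhds h0] with x hx
    rw [glue, if_pos (Set.mem_Ioi.1 hx)]

/-- Dominated convergence for correlations along an arbitrary filter. -/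
theorem tendsto_sampleSum (h : IsDecayPair M ρ P N) {ι : Type*} {𝓤 : Filter ι} {d : ι → ℤ → ℂ}
    {c : ℤ → ℂ} {D δ : ℝ} (hδ : δ < ρ)
    (hd : ∀ᶠ i in 𝓤, ∀ k, ‖d i k‖ ≤ D * Real.exp (δ * |(k : ℝ)|))
    (hc : ∀ k, Tendsto (fun i => d i k) 𝓤 (𝓝 (c k))) {y : ι → ℝ} {v : ℤ → ℂ} (l : ℤ)
    (hy : ∀ i, |y i| ≤ 1)
    (hv : ∀ k : ℤ, Tendsto (fun i => glue P N (y i + (k : ℝ))) 𝓤 (𝓝 (v k))) :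
    Tendsto (fun i => sampleSum (glue P N) (d i) (y i) l) 𝓤 (𝓝 (∑' k, c k * v (k - l))) := by
  obtain ⟨C, hC⟩ := h.exists_decay_glue
  have hC0 : 0 ≤ C := by simpa using (norm_nonneg _).trans (hC 0)
  have hρ := h.rate_pos
  refine tendsto_tsum_of_dominated_convergence
    (bound := fun k : ℤ => D * (C * Real.exp ρ * Real.exp (ρ * |(l : ℝ)|)) *
      Real.exp (-(ρ - δ) * |(k : ℝ)|))
    ((summable_exp_neg_mul_abs_int (sub_pos.2 hδ)).mul_left _)
    (fun k => (hc k).mul (hv (k - l))) ?_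
  filter_upwards [hd] with i hi k
  rw [norm_mul]
  have h2 : ‖glue P N (y i + ((k - l : ℤ) : ℝ))‖ ≤
      C * Real.exp ρ * Real.exp (ρ * |(l : ℝ)|) * Real.exp (-ρ * |(k : ℝ)|) := by
    refine (hC.norm_le_int hρ (hy i) (k - l)).trans ?_
    rw [mul_assoc _ (Real.exp (ρ * _)), ← Real.exp_add]
    refine mul_le_mul_of_nonneg_left (Real.exp_le_exp.2 ?_) (by positivity)
    have := abs_sub_abs_le_abs_sub (k : ℝ) l
    push_cast
    nlinarith
  calc _ ≤ (D * Real.exp (δ * |(k : ℝ)|)) *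
        (C * Real.exp ρ * Real.exp (ρ * |(l : ℝ)|) * Real.exp (-ρ * |(k : ℝ)|)) :=
        mul_le_mul (hi k) h2 (norm_nonneg _) ((norm_nonneg _).trans (hi k))
    _ = D * (C * Real.exp ρ * Real.exp (ρ * |(l : ℝ)|)) *
        (Real.exp (δ * |(k : ℝ)|) * Real.exp (-ρ * |(k : ℝ)|)) := by ring
    _ = _ := by rw [← Real.exp_add]; congr 2; ring

/-- A sequence normalized by `d 0 = 1` cannot make all equations near the origin small while
staying of moderate growth: a limit along an ultrafilter would violate uniqueness. -/
theorem exists_local_bound_normalized (h : IsDecayPair M ρ P N) {E : Set ℤ} {θ : ℤ → ℝ}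
    {x : ℕ → ℝ} (hE : IsBlockPattern M E θ x) {η : ℝ} (hη : 0 < η) :
    ∃ C : ℕ, ∀ ξ ∈ Set.Ioo (0 : ℝ) 1, ∀ d : ℤ → ℂ, d 0 = 1 → ∀ m : ℤ,
      1 ≤ C * ∑' l, expWeight ρ l *
          localEnergy (glue P N) ((fun l => l + m) ⁻¹' E) (fun l => θ (l + m)) d ξ l +
        ENNReal.ofReal η * ∑' k, expWeight ρ k * ‖d k‖ₑ ^ 2 := by
  by_contra! hcon
  choose ξ hξ d hd0 m hsmall using hcon
  have hρ := h.rate_pos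
  have hδ : ρ / 2 < ρ := by linarith
  -- growth bound
  have hgrowth : ∀ n k, ‖d n k‖ ≤ Real.sqrt η⁻¹ * Real.exp (ρ / 2 * |(k : ℝ)|) := by
    intro n k
    refine enorm_sq_le_of_mul_expWeight_le (by positivity) ?_
    have h1 : ENNReal.ofReal η * (expWeight ρ k * ‖d n k‖ₑ ^ 2) ≤ 1 := by
      refine le_trans ?_ (hsmall n).le
      refine le_trans ?_ le_add_self
      gcongr
      exact ENNReal.le_tsum k
    rw [ENNReal.ofReal_inv_of_pos hη]
    rwa [ENNReal.le_inv_iff_mul_le, mul_comm]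
  -- every single equation becomes exact in the limit
  have henergy : ∀ l n, 1 ≤ n → localEnergy (glue P N) ((fun l => l + m n) ⁻¹' E)
      (fun l => θ (l + m n)) (d n) (ξ n) l ≤ (expWeight ρ l)⁻¹ * (n : ℝ≥0∞)⁻¹ := by
    intro l n hn
    have h1 : (n : ℝ≥0∞) * (expWeight ρ l * localEnergy (glue P N) ((fun l => l + m n) ⁻¹' E)
        (fun l => θ (l + m n)) (d n) (ξ n) l) ≤ 1 := by
      refine le_trans ?_ (hsmall n).le
      refine le_trans ?_ le_self_add
      gcongr
      exact ENNReal.le_tsum (f := fun l => expWeight ρ l * localEnergy (glue P N)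
        ((fun l => l + m n) ⁻¹' E) (fun l => θ (l + m n)) (d n) (ξ n) l) l
    have hw0 : expWeight ρ l ≠ 0 := by
      simpa [expWeight] using Real.exp_pos _
    have hn0 : (n : ℝ≥0∞) ≠ 0 := by exact_mod_cast (by omega : n ≠ 0)
    rw [← ENNReal.mul_inv (Or.inl hw0) (Or.inl ENNReal.ofReal_ne_top), ENNReal.le_inv_iff_mul_le]
    calc _ = _ := by ring
      _ ≤ _ := h1
  have hlim0 : ∀ l, Tendsto (fun n : ℕ => (expWeight ρ l)⁻¹ * (n : ℝ≥0∞)⁻¹) atTop (𝓝 0) := by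
    intro l
    have hw0 : expWeight ρ l ≠ 0 := by
      simpa [expWeight] using Real.exp_pos _
    have := ENNReal.Tendsto.const_mul (a := (expWeight ρ l)⁻¹) ENNReal.tendsto_inv_nat_nhds_zero
      (Or.inr (ENNReal.inv_ne_top.2 hw0))
    rwa [mul_zero] at this
  let 𝓤 : Ultrafilter ℕ := hyperfilter ℕ
  have h𝓤 : (𝓤 : Filter ℕ) ≤ atTop := Nat.hyperfilter_le_atTop
  have hge1 : ∀ᶠ n in (𝓤 : Filter ℕ), 1 ≤ n := h𝓤 (eventually_ge_atTop 1)
  have hzero : ∀ {f : ℕ → ℂ} {a : ℂ} (l : ℤ), Tendsto f 𝓤 (𝓝 a) →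
      (∀ᶠ n in (𝓤 : Filter ℕ), ‖f n‖ₑ ^ 2 ≤ localEnergy (glue P N) ((fun l => l + m n) ⁻¹' E)
        (fun l => θ (l + m n)) (d n) (ξ n) l) → a = 0 := by
    intro f a l hf hle
    have h1 : Tendsto (fun n => ‖f n‖ₑ ^ 2) 𝓤 (𝓝 (‖a‖ₑ ^ 2)) :=
      ((ENNReal.continuous_pow 2).tendsto _).comp (hf.enorm)
    have h2 : Tendsto (fun n => ‖f n‖ₑ ^ 2) 𝓤 (𝓝 0) := by
      refine tendsto_of_tendsto_of_tendsto_of_le_of_le' tendsto_const_nhds ((hlim0 l).mono_left h𝓤)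
        (Eventually.of_forall fun _ => zero_le) ?_
      filter_upwards [hle, hge1] with n hn hn1
      exact hn.trans (henergy l n hn1)
    have := tendsto_nhds_unique h1 h2
    simpa using this
  -- limits along the ultrafilter
  have hclim : ∀ k, ∃ a, Tendsto (fun n => d n k) 𝓤 (𝓝 a) := by
    intro k
    obtain ⟨a, -, ha⟩ := (isCompact_closedBall (0 : ℂ)
      (Real.sqrt η⁻¹ * Real.exp (ρ / 2 * |(k : ℝ)|))).ultrafilter_le_nhds (𝓤.map fun n => d n k)
      (by
        rw [le_principal_iff]
        exact Filter.mem_map.2 (univ_mem' fun n => by simpa using hgrowth n k))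
    exact ⟨a, ha⟩
  choose c hc using hclim
  obtain ⟨ξ0, hξ0, hξlim⟩ := (isCompact_Icc (a := (0 : ℝ)) (b := 1)).ultrafilter_le_nhds
    (𝓤.map ξ) (by
      rw [le_principal_iff]
      exact Filter.mem_map.2 (univ_mem' fun n => Set.Ioo_subset_Icc_self (hξ n)))
  replace hξlim : Tendsto ξ 𝓤 (𝓝 ξ0) := hξlim
  have hcg : ∀ k, ‖c k‖ ≤ Real.sqrt η⁻¹ * Real.exp (ρ / 2 * |(k : ℝ)|) := fun k =>
    le_of_tendsto (hc k).norm (Eventually.of_forall fun n => hgrowth n k)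
  have hc0 : c 0 = 1 := tendsto_nhds_unique (hc 0) (by simp [hd0])
  have hfin : c = 0 := by
    refine h.eq_zero_of_equations (by positivity) hδ hcg hξ0 (fun l => ?_)
      (fun n => (hE.mem n).1) hE.tendsto (fun n hn => ?_)
    · refine hzero l (h.tendsto_sampleSum hδ (Eventually.of_forall hgrowth) hc l (y := ξ)
        (v := glueSeq P N ξ0) ?_ ?_) ?_
      · intro n
        rw [abs_le]; constructor <;> linarith [(hξ n).1, (hξ n).2]
      · intro k
        simp only [glue_add_int_eq_glueSeq (hξ _)]
        exact ((h.continuous_glueSeq k).tendsto _).comp hξlim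
      · exact Eventually.of_forall fun n => le_self_add
    · obtain ⟨R, hR⟩ := hE.exists_block n
      choose s hsR hs using fun j => hR (m j)
      obtain ⟨s0, hs0⟩ : ∃ s0, ∀ᶠ j in (𝓤 : Filter ℕ), s j = s0 := by
        have hmem : Set.Icc (-(R : ℤ)) R ∈ 𝓤.map s :=
          Filter.mem_map.2 (univ_mem' fun j => abs_le.1 (hsR j))
        obtain ⟨s0, -, hs0⟩ := Ultrafilter.eq_pure_of_finite_mem (Set.finite_Icc _ _) hmem
        refine ⟨s0, ?_⟩
        have : ({s0} : Set ℤ) ∈ 𝓤.map s := by rw [hs0]; exact Set.mem_singleton _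
        exact this
      refine ⟨s0, fun i hi => ?_⟩
      have hxn := hE.mem n
      refine hzero (s0 + i) (h.tendsto_sampleSum hδ (Eventually.of_forall hgrowth) hc (s0 + i)
        (y := fun j => ξ j - x n) (v := fun k => glue P N (ξ0 - x n + (k : ℝ))) ?_ ?_) ?_
      · intro j
        rw [abs_le]; constructor <;> linarith [(hξ j).1, (hξ j).2, hxn.1, hxn.2]
      · intro k
        have hne : ξ0 - x n + (k : ℝ) ≠ 0 := by
          intro h0
          have h1 : (-1 : ℝ) < k := by linarith [hξ0.2, hxn.1]
          have h2 : (k : ℝ) < 1 := by linarith [hξ0.1, hxn.2]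
          have h3 : -1 < k := by exact_mod_cast h1
          have h4 : k < 1 := by exact_mod_cast h2
          obtain rfl : k = 0 := by omega
          apply hn
          rw [Int.cast_zero] at h0
          linarith
        exact (h.continuousAt_glue hne).tendsto.comp ((hξlim.sub_const (x n)).add_const _)
      · filter_upwards [hs0] with j hj
        obtain ⟨h1, h2⟩ := hs j i hi
        rw [hj] at h1 h2
        unfold localEnergy
        rw [Set.indicator_of_mem (by exact h1)]
        beta_reduce
        rw [h2]
        exact le_add_self
  rw [hfin] at hc0
  exact zero_ne_one hc0

/-- Local form of the lower frame bound, up to a small multiple of the weighted norm. -/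
theorem exists_local_bound (h : IsDecayPair M ρ P N) {E : Set ℤ} {θ : ℤ → ℝ}
    {x : ℕ → ℝ} (hE : IsBlockPattern M E θ x) {η : ℝ} (hη : 0 < η) :
    ∃ C : ℕ, ∀ ξ ∈ Set.Ioo (0 : ℝ) 1, ∀ c : ℤ → ℂ, ∀ m : ℤ,
      ‖c m‖ₑ ^ 2 ≤ C * ∑' l, expWeight ρ (l - m) * localEnergy (glue P N) E θ c ξ l +
        ENNReal.ofReal η * ∑' k, expWeight ρ (k - m) * ‖c k‖ₑ ^ 2 := by
  obtain ⟨C, hC⟩ := h.exists_local_bound_normalized hE hη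
  refine ⟨C, fun ξ hξ c m => ?_⟩
  by_cases h0 : c m = 0
  · simp [h0]
  have h1 := hC ξ hξ (fun k => (c m)⁻¹ * c (k + m)) (by simp [h0]) m
  have e1 : ∀ l, localEnergy (glue P N) ((fun l => l + m) ⁻¹' E) (fun l => θ (l + m))
      (fun k => (c m)⁻¹ * c (k + m)) ξ l =
      ‖(c m)⁻¹‖ₑ ^ 2 * localEnergy (glue P N) E θ c ξ (l + m) := by
    intro l
    unfold localEnergy
    simp only [sampleSum_shift_smul, enorm_mul, mul_pow, mul_add]
    congr 1
    by_cases hl : l + m ∈ E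
    · rw [Set.indicator_of_mem (by exact hl), Set.indicator_of_mem hl]
    · rw [Set.indicator_of_notMem (by exact hl), Set.indicator_of_notMem hl, mul_zero]
  have e2 : ∑' l, expWeight ρ l * (‖(c m)⁻¹‖ₑ ^ 2 * localEnergy (glue P N) E θ c ξ (l + m)) =
      ‖(c m)⁻¹‖ₑ ^ 2 * ∑' l, expWeight ρ (l - m) * localEnergy (glue P N) E θ c ξ l := by
    rw [← (Equiv.addRight m).tsum_eq (fun l => expWeight ρ (l - m) * _), ← ENNReal.tsum_mul_left]
    refine tsum_congr fun l => ?_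
    rw [Equiv.coe_addRight, add_sub_cancel_right]; ring
  have e3 : ∑' k, expWeight ρ k * ‖(c m)⁻¹ * c (k + m)‖ₑ ^ 2 =
      ‖(c m)⁻¹‖ₑ ^ 2 * ∑' k, expWeight ρ (k - m) * ‖c k‖ₑ ^ 2 := by
    rw [← (Equiv.addRight m).tsum_eq (fun l => expWeight ρ (l - m) * _), ← ENNReal.tsum_mul_left]
    refine tsum_congr fun l => ?_
    rw [Equiv.coe_addRight, add_sub_cancel_right, enorm_mul, mul_pow]; ring
  simp only [e1] at h1
  rw [e2, e3] at h1
  have hinv : ‖c m‖ₑ ^ 2 * ‖(c m)⁻¹‖ₑ ^ 2 = 1 := by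
    rw [← mul_pow, ← enorm_mul, mul_inv_cancel₀ h0]; simp
  set A := ∑' l, expWeight ρ (l - m) * localEnergy (glue P N) E θ c ξ l
  set B := ∑' k, expWeight ρ (k - m) * ‖c k‖ₑ ^ 2
  calc ‖c m‖ₑ ^ 2 = ‖c m‖ₑ ^ 2 * 1 := (mul_one _).symm
    _ ≤ ‖c m‖ₑ ^ 2 * (C * (‖(c m)⁻¹‖ₑ ^ 2 * A) + ENNReal.ofReal η * (‖(c m)⁻¹‖ₑ ^ 2 * B)) := by
        gcongr
    _ = (‖c m‖ₑ ^ 2 * ‖(c m)⁻¹‖ₑ ^ 2) *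
        (C * A + ENNReal.ofReal η * B) := by ring
    _ = _ := by rw [hinv, one_mul]

end IsDecayPair

/-! ### Frame bounds -/

/-- The frequencies `l` for `l ∈ ℤ` (left summand) and `l + θ l` for `l ∈ E` (right summand). -/
noncomputable def frequencyPoint {E : Set ℤ} (θ : ℤ → ℝ) : ℤ ⊕ E → ℝ :=
  Sum.elim (fun l => (l : ℝ)) (fun l => ((l : ℤ) : ℝ) + θ l)

theorem frequencyPoint_injective {E : Set ℤ} {θ : ℤ → ℝ} (hθ : ∀ l, θ l ∈ Set.Ioo (0 : ℝ) 1) :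
    Function.Injective (frequencyPoint (E := E) θ) := by
  have key : ∀ (a : ℤ) (s : ℝ), 0 ≤ s → s < 1 → ⌊(a : ℝ) + s⌋ = a := by
    intro a s h0 h1
    rw [Int.floor_intCast_add, Int.floor_eq_zero_iff.2 ⟨h0, h1⟩, add_zero]
  have hne : ∀ (l : ℤ) (l' : ℤ), (l : ℝ) ≠ (l' : ℝ) + θ l' := by
    intro l l' h
    have h1 := congrArg Int.floor h
    rw [key _ _ (hθ l').1.le (hθ l').2, Int.floor_intCast] at h1
    rw [h1] at h
    linarith [(hθ l').1]
  rintro (l | l) (l' | l') h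
  · simpa [frequencyPoint] using h
  · exact absurd h (hne l l')
  · exact absurd h.symm (hne l' l)
  · have h1 := congrArg Int.floor (show ((l : ℤ) : ℝ) + θ l = ((l' : ℤ) : ℝ) + θ l' from h)
    rw [key _ _ (hθ l).1.le (hθ l).2, key _ _ (hθ l').1.le (hθ l').2] at h1
    rw [Subtype.ext h1]

theorem tsum_frequencyPoint {E : Set ℤ} {θ : ℤ → ℝ} (hθ : ∀ l, θ l ∈ Set.Ioo (0 : ℝ) 1)
    (f : ℝ × ℝ → ℝ≥0∞) :
    ∑' p : (Set.range (frequencyPoint (E := E) θ) ×ˢ Set.range (fun n : ℤ => (n : ℝ)) :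
      Set (ℝ × ℝ)), f p =
    ∑' l : ℤ, (∑' n : ℤ, f (l, n) + E.indicator (fun l => ∑' n : ℤ, f (l + θ l, n)) l) := by
  rw [← Set.range_prodMap, tsum_range f
    ((frequencyPoint_injective hθ).prodMap Int.cast_injective), ENNReal.tsum_prod',
    Summable.tsum_sum ENNReal.summable ENNReal.summable, ENNReal.tsum_add, ← tsum_subtype]
  rfl

theorem isGaborFrame_of_lintegral_bounds {g : ℝ → ℂ} {L : Set (ℝ × ℝ)} (hg : MemLp g 2 volume)
    {a b : ℝ≥0∞} (ha : a ≠ ∞) (hb : b ≠ ∞)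
    (hlow : ∀ f : ℝ → ℂ, MemLp f 2 volume → ∫⁻ t, ‖f t‖ₑ ^ 2 ≤
      a * ∑' p : L, ‖innerL2 f (timeFreqShift p.1.1 p.1.2 g)‖ₑ ^ 2)
    (hup : ∀ f : ℝ → ℂ, MemLp f 2 volume →
      ∑' p : L, ‖innerL2 f (timeFreqShift p.1.1 p.1.2 g)‖ₑ ^ 2 ≤ b * ∫⁻ t, ‖f t‖ₑ ^ 2) :
    IsGaborFrame g L := by
  have hpow : ∀ z : ℂ, ‖z‖ ^ 2 = (‖z‖ₑ ^ 2).toReal := by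
    intro z; simp
  refine ⟨hg, (a.toReal + 1)⁻¹, b.toReal + 1, by positivity, by positivity, fun f hf => ?_⟩
  set S := ∑' p : L, ‖innerL2 f (timeFreqShift p.1.1 p.1.2 g)‖ₑ ^ 2 with hS
  have hfin : ∫⁻ t, ‖f t‖ₑ ^ 2 ≠ ∞ := by
    have := hf.2
    rw [eLpNorm_lt_top_iff_lintegral_rpow_enorm_lt_top (by norm_num) (by norm_num)] at this
    simpa using this.ne
  have hint : ∫ t, ‖f t‖ ^ 2 = (∫⁻ t, ‖f t‖ₑ ^ 2).toReal := by
    simp only [hpow]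
    refine integral_toReal (hf.1.enorm.pow_const 2) (Eventually.of_forall fun t => ?_)
    finiteness
  have hSfin : S ≠ ∞ := ne_top_of_le_ne_top (ENNReal.mul_ne_top hb hfin) (hup f hf)
  have hSsum : ∑' p : L, ‖innerL2 f (timeFreqShift p.1.1 p.1.2 g)‖ ^ 2 = S.toReal := by
    simp only [hpow]
    rw [hS, ENNReal.tsum_toReal_eq fun p => by finiteness]
  refine ⟨?_, ?_, ?_⟩
  · simp only [hpow]
    exact ENNReal.summable_toReal hSfin
  · rw [hSsum, hint, inv_mul_le_iff₀ (by positivity)]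
    have h1 := ENNReal.toReal_mono (ENNReal.mul_ne_top ha hSfin) (hlow f hf)
    rw [ENNReal.toReal_mul] at h1
    have : 0 ≤ S.toReal := ENNReal.toReal_nonneg
    linarith
  · rw [hSsum, hint]
    have h1 := ENNReal.toReal_mono (ENNReal.mul_ne_top hb hfin) (hup f hf)
    rw [ENNReal.toReal_mul] at h1
    have : 0 ≤ (∫⁻ t, ‖f t‖ₑ ^ 2).toReal := ENNReal.toReal_nonneg
    linarith

theorem ExpDecay.enorm_sampleSum_sq_le {C ρ : ℝ} {φ : ℝ → ℂ} (h : ExpDecay C ρ φ) (hρ : 0 < ρ)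
    (c : ℤ → ℂ) {y : ℝ} (hy : |y| ≤ 1) (l : ℤ) :
    ‖sampleSum φ c y l‖ₑ ^ 2 ≤ ENNReal.ofReal (C * Real.exp ρ) ^ 2 * (∑' k, expWeight ρ k) *
      ∑' k, expWeight ρ (k - l) * ‖c k‖ₑ ^ 2 :=
  enorm_tsum_mul_sq_le c _ l fun k => h.norm_le_int hρ hy (k - l)

namespace IsDecayPair

variable {M : ℕ} {ρ : ℝ} {P N : ℂ → ℂ}

theorem exists_upper_bound (h : IsDecayPair M ρ P N) {E : Set ℤ} {θ : ℤ → ℝ}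
    (hθ : ∀ l, θ l ∈ Set.Ioo (0 : ℝ) 1) :
    ∃ b : ℝ≥0∞, b ≠ ∞ ∧ ∀ ξ ∈ Set.Ioo (0 : ℝ) 1, ∀ c : ℤ → ℂ,
      ∑' l, localEnergy (glue P N) E θ c ξ l ≤ b * ∑' k, ‖c k‖ₑ ^ 2 := by
  obtain ⟨C, hC⟩ := h.exists_decay_glue
  have hρ := h.rate_pos
  set W := ∑' k, expWeight ρ k with hW
  have hWtop : W ≠ ∞ := tsum_expWeight_ne_top hρ
  set B := ENNReal.ofReal (C * Real.exp ρ) ^ 2 * W with hB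
  have hBtop : B ≠ ∞ := ENNReal.mul_ne_top (by finiteness) hWtop
  refine ⟨2 * B * W, ENNReal.mul_ne_top (ENNReal.mul_ne_top (by simp) hBtop) hWtop,
    fun ξ hξ c => ?_⟩
  have h1 : ∀ l, localEnergy (glue P N) E θ c ξ l ≤
      2 * B * ∑' k, expWeight ρ (k - l) * ‖c k‖ₑ ^ 2 := by
    intro l
    rw [mul_assoc, two_mul]
    refine add_le_add (hC.enorm_sampleSum_sq_le hρ c ?_ l) ?_
    · rw [abs_le]; constructor <;> linarith [hξ.1, hξ.2]
    · refine (Set.indicator_le_self _ _ _).trans (hC.enorm_sampleSum_sq_le hρ c ?_ l)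
      have := hθ l
      rw [abs_le]; constructor <;> linarith [hξ.1, hξ.2, this.1, this.2]
  calc _ ≤ ∑' l, 2 * B * ∑' k, expWeight ρ (k - l) * ‖c k‖ₑ ^ 2 := ENNReal.tsum_le_tsum h1
    _ = 2 * B * ∑' k, ∑' l, expWeight ρ (k - l) * ‖c k‖ₑ ^ 2 := by
        rw [ENNReal.tsum_mul_left, ENNReal.tsum_comm]
    _ = 2 * B * W * ∑' k, ‖c k‖ₑ ^ 2 := by
        simp only [ENNReal.tsum_mul_right, tsum_expWeight_sub_left, ← hW, ENNReal.tsum_mul_left]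
        ring

theorem exists_lower_bound (h : IsDecayPair M ρ P N) {E : Set ℤ} {θ : ℤ → ℝ} {x : ℕ → ℝ}
    (hE : IsBlockPattern M E θ x) :
    ∃ a : ℝ≥0∞, a ≠ ∞ ∧ ∀ ξ ∈ Set.Ioo (0 : ℝ) 1, ∀ c : ℤ → ℂ, ∑' k, ‖c k‖ₑ ^ 2 ≠ ∞ →
      ∑' k, ‖c k‖ₑ ^ 2 ≤ a * ∑' l, localEnergy (glue P N) E θ c ξ l := by
  set W := ∑' k, expWeight ρ k with hW
  have hWtop : W ≠ ∞ := tsum_expWeight_ne_top h.rate_pos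
  have hW0 : W ≠ 0 := by
    intro h0
    have := ENNReal.tsum_eq_zero.1 h0 0
    simp [expWeight] at this
  have hWpos : 0 < W.toReal := ENNReal.toReal_pos hW0 hWtop
  -- summing the local estimate, the error term is absorbed when `η W = 1 / 2`
  obtain ⟨C, hC⟩ := h.exists_local_bound hE (η := (2 * W.toReal)⁻¹) (by positivity)
  have hη : ENNReal.ofReal (2 * W.toReal)⁻¹ * W = 2⁻¹ := by
    rw [← ENNReal.ofReal_toReal hWtop, ENNReal.toReal_ofReal hWpos.le,
      ← ENNReal.ofReal_mul (by positivity), mul_inv, mul_assoc, inv_mul_cancel₀ hWpos.ne',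
      mul_one, ENNReal.ofReal_inv_of_pos two_pos]
    simp
  refine ⟨2 * (C * W), ENNReal.mul_ne_top (by simp) (ENNReal.mul_ne_top (by simp) hWtop),
    fun ξ hξ c hc => ?_⟩
  have hswap : ∀ f : ℤ → ℝ≥0∞, ∑' m, ∑' l, expWeight ρ (l - m) * f l = W * ∑' l, f l := by
    intro f
    rw [ENNReal.tsum_comm]
    simp only [ENNReal.tsum_mul_right, tsum_expWeight_sub_left, ← hW, ENNReal.tsum_mul_left]
  have h1 : ∑' k, ‖c k‖ₑ ^ 2 ≤ C * W * ∑' l, localEnergy (glue P N) E θ c ξ l +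
      2⁻¹ * ∑' k, ‖c k‖ₑ ^ 2 := by
    refine (ENNReal.tsum_le_tsum (hC ξ hξ c)).trans (le_of_eq ?_)
    rw [ENNReal.tsum_add, ENNReal.tsum_mul_left, ENNReal.tsum_mul_left, hswap, hswap,
      ← mul_assoc, ← mul_assoc, hη]
  set T := ∑' k, ‖c k‖ₑ ^ 2
  have h2 : 2⁻¹ * T ≤ C * W * ∑' l, localEnergy (glue P N) E θ c ξ l := by
    have h3 : 2⁻¹ * T + 2⁻¹ * T ≤
        C * W * (∑' l, localEnergy (glue P N) E θ c ξ l) + 2⁻¹ * T := by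
      rw [← add_mul, ENNReal.inv_two_add_inv_two, one_mul]; exact h1
    exact (ENNReal.add_le_add_iff_right (ENNReal.mul_ne_top (by simp) hc)).1 h3
  calc T = 2 * (2⁻¹ * T) := by
        rw [← mul_assoc, ENNReal.mul_inv_cancel (by simp) (by simp), one_mul]
    _ ≤ 2 * (C * W * ∑' l, localEnergy (glue P N) E θ c ξ l) := by gcongr
    _ = _ := by ring

/-- The window whose Fourier transform is glued from a decay pair generates a frame over the
frequencies of any block pattern. -/
theorem isGaborFrame (h : IsDecayPair M ρ P N) {E : Set ℤ} {θ : ℤ → ℝ} {x : ℕ → ℝ}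
    (hE : IsBlockPattern M E θ x) :
    IsGaborFrame (𝓕⁻ (glue P N))
      (Set.range (frequencyPoint (E := E) θ) ×ˢ Set.range (fun n : ℤ => (n : ℝ))) := by
  obtain ⟨C, hC⟩ := h.exists_decay_glue
  have hρ := h.rate_pos
  have hm := h.measurable_glue
  obtain ⟨a, ha, hlow⟩ := h.exists_lower_bound hE
  obtain ⟨b, hb, hup⟩ := h.exists_upper_bound (E := E) hE.shift_mem
  set c : (ℝ → ℂ) → ℝ → ℤ → ℂ := fun F ξ k => (starRingEnd ℂ) (F (ξ + k)) with hcdef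
  have hnorm : ∀ (F : ℝ → ℂ) (ξ : ℝ), ∑' k, ‖c F ξ k‖ₑ ^ 2 = ∑' k : ℤ, ‖F (ξ + k)‖ₑ ^ 2 := by
    intro F ξ
    refine tsum_congr fun k => ?_
    rw [hcdef, RCLike.enorm_conj]
  have hcoef : ∀ (F : ℝ → ℂ) (ξ s : ℝ) (l : ℤ),
      ‖∑' k : ℤ, F (ξ + k) * (starRingEnd ℂ) (glue P N (ξ + k - (l + s)))‖ₑ =
      ‖sampleSum (glue P N) (c F ξ) (ξ - s) l‖ₑ := by
    intro F ξ s l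
    rw [← RCLike.enorm_conj, Complex.conj_tsum]
    unfold sampleSum
    congr 1
    refine tsum_congr fun k => ?_
    rw [map_mul, Complex.conj_conj]
    congr 2
    push_cast; ring
  have hmain : ∀ f : ℝ → ℂ, MemLp f 2 volume → ∃ F : ℝ → ℂ, MemLp F 2 volume ∧
      ∫⁻ t, ‖f t‖ₑ ^ 2 = ∫⁻ ξ in Set.Ioo (0 : ℝ) 1, ∑' k, ‖c F ξ k‖ₑ ^ 2 ∧
      ∑' p : (Set.range (frequencyPoint (E := E) θ) ×ˢ Set.range (fun n : ℤ => (n : ℝ)) :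
        Set (ℝ × ℝ)), ‖innerL2 f (timeFreqShift p.1.1 p.1.2 (𝓕⁻ (glue P N)))‖ₑ ^ 2 =
      ∫⁻ ξ in Set.Ioo (0 : ℝ) 1, ∑' l, localEnergy (glue P N) E θ (c F ξ) ξ l := by
    intro f hf
    obtain ⟨F, hF, hFf, hpair⟩ := exists_plancherel hf
    have hL2 := hC.memLp_two hρ hm
    refine ⟨F, hF, ?_, ?_⟩
    · rw [← hFf, lintegral_eq_setLIntegral_tsum (hF.1.enorm.pow_const 2),
        Measure.restrict_congr_set Ioo_ae_eq_Ioc]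
      simp only [hnorm]
    · rw [tsum_frequencyPoint hE.shift_mem
        (fun p => ‖innerL2 f (timeFreqShift p.1 p.2 (𝓕⁻ (glue P N)))‖ₑ ^ 2)]
      simp only [tsum_enorm_sq_innerL2 hC hρ hm hF hpair]
      have hmeas : ∀ lam : ℝ, AEMeasurable (fun x : ℝ =>
          ‖∑' k : ℤ, F (x + k) * (starRingEnd ℂ) (glue P N (x + k - lam))‖ₑ ^ 2)
          (volume.restrict (Set.Ioc (0 : ℝ) 1)) := fun lam =>
        ((aestronglyMeasurable_periodization
          (integrable_mul_conj_shift hL2 hF lam)).enorm).pow_const 2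
      have hterm : ∀ (ξ : ℝ) (l : ℤ), localEnergy (glue P N) E θ (c F ξ) ξ l =
          ‖∑' k : ℤ, F (ξ + k) * (starRingEnd ℂ) (glue P N (ξ + k - l))‖ₑ ^ 2 +
          E.indicator (fun l : ℤ => ‖∑' k : ℤ, F (ξ + k) *
            (starRingEnd ℂ) (glue P N (ξ + k - (l + θ l)))‖ₑ ^ 2) l := by
        intro ξ l
        unfold localEnergy
        simp only [hcoef]
        have := hcoef F ξ 0 l
        rw [sub_zero, add_zero] at this
        rw [this]
      have hind : ∀ l : ℤ, AEMeasurable (fun ξ : ℝ => E.indicator (fun l : ℤ => ‖∑' k : ℤ,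
          F (ξ + k) * (starRingEnd ℂ) (glue P N (ξ + k - (l + θ l)))‖ₑ ^ 2) l)
          (volume.restrict (Set.Ioc (0 : ℝ) 1)) := by
        intro l
        by_cases hl : l ∈ E
        · simp only [Set.indicator_of_mem hl]; exact hmeas _
        · simp only [Set.indicator_of_notMem hl]; exact aemeasurable_const
      rw [Measure.restrict_congr_set Ioo_ae_eq_Ioc, lintegral_tsum]
      · refine tsum_congr fun l => ?_
        simp only [hterm]
        rw [lintegral_add_left' (hmeas _)]
        congr 1
        by_cases hl : l ∈ E
        · simp only [Set.indicator_of_mem hl]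
        · simp only [Set.indicator_of_notMem hl, lintegral_zero]
      · intro l
        simp only [hterm]
        exact (hmeas _).add (hind l)
  refine isGaborFrame_of_lintegral_bounds
    (memLp_fourierInv (hC.integrable hρ hm) (hC.memLp_two hρ hm)) ha hb ?_ ?_
  · intro f hf
    obtain ⟨F, hF, h1, h2⟩ := hmain f hf
    rw [h2, h1, ← lintegral_const_mul' _ _ ha]
    have hfin : ∫⁻ ξ in Set.Ioc (0 : ℝ) 1, ∑' k : ℤ, ‖F (ξ + k)‖ₑ ^ 2 ≠ ∞ := by
      rw [← lintegral_eq_setLIntegral_tsum (hF.1.enorm.pow_const 2)]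
      have := hF.2
      rw [eLpNorm_lt_top_iff_lintegral_rpow_enorm_lt_top (by norm_num) (by norm_num)] at this
      simpa using this.ne
    have hmeas : AEMeasurable (fun ξ : ℝ => ∑' k : ℤ, ‖F (ξ + k)‖ₑ ^ 2)
        (volume.restrict (Set.Ioc (0 : ℝ) 1)) := by
      refine AEMeasurable.tsum fun k => ?_
      exact ((hF.1.enorm.pow_const 2).comp_quasiMeasurePreserving
        (measurePreserving_add_right volume (k : ℝ)).quasiMeasurePreserving).restrict
    have hae := ae_lt_top' hmeas hfin
    rw [← Measure.restrict_congr_set Ioo_ae_eq_Ioc] at hae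
    refine lintegral_mono_ae ?_
    filter_upwards [hae, ae_restrict_mem measurableSet_Ioo] with ξ hξ1 hξ2
    exact hlow ξ hξ2 _ (by rw [hnorm]; exact hξ1.ne)
  · intro f hf
    obtain ⟨F, hF, h1, h2⟩ := hmain f hf
    rw [h2, h1, ← lintegral_const_mul' _ _ hb]
    exact setLIntegral_mono' measurableSet_Ioo fun ξ hξ => hup ξ hξ _

end IsDecayPair

/-! ### Rational windows and their Fourier transforms -/

theorem pow_le_const_mul_exp {η : ℝ} (hη : 0 < η) (n : ℕ) {x : ℝ} (hx : 0 ≤ x) :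
    x ^ n ≤ n.factorial / η ^ n * Real.exp (η * x) := by
  have h := Real.pow_div_factorial_le_exp _ (mul_nonneg hη.le hx) n
  rw [div_le_iff₀ (by positivity), mul_pow] at h
  rw [div_mul_eq_mul_div, le_div_iff₀ (by positivity)]
  linarith

theorem norm_pow_mul_exp_neg_le {r : ℂ} (hr : 0 < r.re) (n : ℕ) {x : ℝ} (hx : 0 ≤ x) :
    ‖(x : ℂ) ^ n * Complex.exp (-(r * x))‖ ≤
      n.factorial / (r.re / 2) ^ n * Real.exp (-(r.re / 2) * x) := by
  have h := pow_le_const_mul_exp (half_pos hr) n hx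
  rw [norm_mul, norm_pow, Complex.norm_exp, Complex.norm_real, Real.norm_of_nonneg hx]
  calc _ ≤ n.factorial / (r.re / 2) ^ n * Real.exp (r.re / 2 * x) *
        Real.exp (-(r * x)).re := by gcongr
    _ = _ := by
        rw [mul_assoc, ← Real.exp_add]
        congr 2
        simp
        ring

theorem integrableOn_pow_mul_exp_neg {r : ℂ} (hr : 0 < r.re) (n : ℕ) :
    IntegrableOn (fun x : ℝ => (x : ℂ) ^ n * Complex.exp (-(r * x))) (Set.Ioi 0) := by
  refine Integrable.mono' ((exp_neg_integrableOn_Ioi 0 (half_pos hr)).const_mul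
    (n.factorial / (r.re / 2) ^ n))
    (by fun_prop) ?_
  filter_upwards [ae_restrict_mem measurableSet_Ioi] with x hx
  exact norm_pow_mul_exp_neg_le hr n (le_of_lt hx)

theorem tendsto_pow_mul_exp_neg {r : ℂ} (hr : 0 < r.re) (n : ℕ) :
    Tendsto (fun x : ℝ => (x : ℂ) ^ n * Complex.exp (-(r * x))) atTop (𝓝 0) := by
  have h : Tendsto (fun x : ℝ => n.factorial / (r.re / 2) ^ n * Real.exp (-(r.re / 2) * x)) atTop
      (𝓝 (n.factorial / (r.re / 2) ^ n * 0)) :=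
    (Real.tendsto_exp_atBot.comp
      (tendsto_id.const_mul_atTop_of_neg (neg_lt_zero.2 (half_pos hr)))).const_mul _
  rw [mul_zero] at h
  refine squeeze_zero_norm' ?_ h
  filter_upwards [eventually_ge_atTop 0] with x hx
  exact norm_pow_mul_exp_neg_le hr n hx

theorem integral_pow_mul_exp_neg {r : ℂ} (hr : 0 < r.re) (n : ℕ) :
    ∫ x : ℝ in Set.Ioi 0, (x : ℂ) ^ n * Complex.exp (-(r * x)) = n.factorial / r ^ (n + 1) := by
  have hr0 : r ≠ 0 := by rintro rfl; simp at hr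
  have hexp : ∀ x : ℝ, HasDerivAt (fun x : ℝ => Complex.exp (-(r * x)))
      (Complex.exp (-(r * x)) * -r) x := by
    intro x
    have := (((hasDerivAt_id (x : ℂ)).const_mul r).neg.cexp).comp_ofReal
    simpa using this
  induction n with
  | zero =>
    have h0 := integral_Ioi_of_hasDerivAt_of_tendsto' (a := 0) (m := 0)
      (f := fun x : ℝ => Complex.exp (-(r * x)) * (-r)⁻¹)
      (f' := fun x : ℝ => Complex.exp (-(r * x)))
      (fun x _ => by
        have := (hexp x).mul_const (-r)⁻¹
        rwa [mul_assoc, mul_inv_cancel₀ (neg_ne_zero.2 hr0), mul_one] at this)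
      (by simpa using integrableOn_pow_mul_exp_neg hr 0)
      (by simpa using (tendsto_pow_mul_exp_neg hr 0).mul_const (-r)⁻¹)
    simp only [pow_zero, one_mul, h0]
    simp
  | succ n ih =>
    have hpow : ∀ x : ℝ, HasDerivAt (fun x : ℝ => (x : ℂ) ^ (n + 1)) (((n + 1 : ℕ) : ℂ) * x ^ n) x := by
      intro x
      simpa using (hasDerivAt_pow (n + 1) (x : ℂ)).comp_ofReal
    have h0 := integral_Ioi_of_hasDerivAt_of_tendsto' (a := 0) (m := 0)
      (f := fun x : ℝ => (x : ℂ) ^ (n + 1) * Complex.exp (-(r * x)))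
      (f' := fun x : ℝ => ((n + 1 : ℕ) : ℂ) * (x ^ n * Complex.exp (-(r * x))) -
        r * (x ^ (n + 1) * Complex.exp (-(r * x))))
      (fun x _ => by
        refine ((hpow x).mul (hexp x)).congr_deriv ?_
        ring)
      (((integrableOn_pow_mul_exp_neg hr n).const_mul _).sub
        ((integrableOn_pow_mul_exp_neg hr (n + 1)).const_mul _))
      (tendsto_pow_mul_exp_neg hr (n + 1))
    rw [integral_sub ((integrableOn_pow_mul_exp_neg hr n).const_mul _)
      ((integrableOn_pow_mul_exp_neg hr (n + 1)).const_mul _), integral_const_mul,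
      integral_const_mul, ih] at h0
    simp only [Complex.ofReal_zero, ne_eq, Nat.add_eq_zero_iff, one_ne_zero, and_false,
      not_false_eq_true, zero_pow, zero_mul, sub_zero] at h0
    have h1 : ∫ x : ℝ in Set.Ioi 0, (x : ℂ) ^ (n + 1) * Complex.exp (-(r * x)) =
        ((n + 1 : ℕ) : ℂ) * (n.factorial / r ^ (n + 1)) / r := by
      rw [sub_eq_zero.1 h0, mul_div_cancel_left₀ _ hr0]
    rw [h1, Nat.factorial_succ]
    push_cast
    field_simp
    ring

/-- The exponential polynomial `2πi a (-2πi z)^{j-1} / (j-1)! e^{2πwz}`. On one of the half lines,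
up to sign, it is the Fourier transform of `a / (t - iw)^j`. -/
noncomputable def fourierTerm (a w : ℂ) (j : ℕ) (z : ℂ) : ℂ :=
  2 * Real.pi * Complex.I * a * (-(2 * Real.pi * Complex.I * z)) ^ (j - 1) /
    ((j - 1).factorial : ℂ) * Complex.exp (2 * Real.pi * w * z)

/-- The part of the Fourier transform of `a / (t - iw)^j` on the positive half line. -/
noncomputable def rightTerm (a w : ℂ) (j : ℕ) (z : ℂ) : ℂ :=
  if w.re < 0 then -fourierTerm a w j z else 0

/-- The part of the Fourier transform of `a / (t - iw)^j` on the negative half line. -/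
noncomputable def leftTerm (a w : ℂ) (j : ℕ) (z : ℂ) : ℂ :=
  if w.re < 0 then 0 else fourierTerm a w j z

theorem rightTerm_sub_leftTerm (a w : ℂ) (j : ℕ) (z : ℂ) :
    rightTerm a w j z - leftTerm a w j z = -fourierTerm a w j z := by
  unfold rightTerm leftTerm
  split_ifs <;> simp

theorem differentiable_fourierTerm (a w : ℂ) (j : ℕ) : Differentiable ℂ (fourierTerm a w j) := by
  unfold fourierTerm
  fun_prop

theorem differentiable_rightTerm (a w : ℂ) (j : ℕ) : Differentiable ℂ (rightTerm a w j) := by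
  have := differentiable_fourierTerm a w j
  unfold rightTerm
  split_ifs
  · exact this.neg
  · fun_prop

theorem differentiable_leftTerm (a w : ℂ) (j : ℕ) : Differentiable ℂ (leftTerm a w j) := by
  have := differentiable_fourierTerm a w j
  unfold leftTerm
  split_ifs
  · fun_prop
  · exact this

theorem fourierTerm_neg (a w : ℂ) (j : ℕ) (z : ℂ) :
    fourierTerm a w j (-z) = fourierTerm (a * (-1) ^ (j - 1)) (-w) j z := by
  unfold fourierTerm
  rw [show -(2 * Real.pi * Complex.I * -z) = (-1) * (-(2 * Real.pi * Complex.I * z)) by ring,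
    mul_pow, show 2 * Real.pi * w * -z = 2 * Real.pi * -w * z by ring]
  ring

theorem exists_decay_fourierTerm (a : ℂ) {w : ℂ} (j : ℕ) {ρ : ℝ}
    (hρ : ρ < 2 * Real.pi * -w.re) (R : ℝ) : ∃ C : ℝ, ∀ z : ℂ, |z.im| ≤ R → -R ≤ z.re →
      ‖fourierTerm a w j z‖ ≤ C * Real.exp (-ρ * |z.re|) := by
  set η := 2 * Real.pi * -w.re - ρ with hη
  have hη0 : 0 < η := sub_pos.2 hρ
  set n := j - 1
  refine ⟨2 * Real.pi * ‖a‖ * (2 * Real.pi) ^ n / n.factorial * (n.factorial / η ^ n) *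
    Real.exp (η * R + 4 * Real.pi * |w.re| * R + 2 * Real.pi * |w.im| * R), fun z him hre => ?_⟩
  have hR : 0 ≤ R := (abs_nonneg _).trans him
  have hpi := Real.pi_pos
  have h1 : ‖fourierTerm a w j z‖ = 2 * Real.pi * ‖a‖ * (2 * Real.pi) ^ n / n.factorial *
      (‖z‖ ^ n * Real.exp (2 * Real.pi * (w.re * z.re - w.im * z.im))) := by
    unfold fourierTerm
    rw [norm_mul, Complex.norm_exp]
    have : (2 * Real.pi * w * z : ℂ).re = 2 * Real.pi * (w.re * z.re - w.im * z.im) := by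
      simp [Complex.mul_re, Complex.mul_im]
      ring
    rw [this]
    simp only [norm_mul, norm_div, norm_pow, norm_neg, Complex.norm_I, Complex.norm_real,
      Complex.norm_natCast, Complex.norm_ofNat, Real.norm_of_nonneg hpi.le, mul_pow]
    ring
  have h2 := pow_le_const_mul_exp hη0 n (norm_nonneg z)
  have h3 : η * ‖z‖ + 2 * Real.pi * (w.re * z.re - w.im * z.im) ≤
      (η * R + 4 * Real.pi * |w.re| * R + 2 * Real.pi * |w.im| * R) + -ρ * |z.re| := by
    have e1 : ‖z‖ ≤ |z.re| + R := (Complex.norm_le_abs_re_add_abs_im z).trans (by linarith)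
    have e2 : w.re * z.re ≤ w.re * |z.re| + 2 * |w.re| * R := by
      rcases le_total 0 z.re with h | h
      · rw [abs_of_nonneg h]
        have : 0 ≤ 2 * |w.re| * R := by positivity
        linarith
      · rw [abs_of_nonpos h]
        have := neg_abs_le w.re
        have := le_abs_self w.re
        nlinarith [abs_nonneg w.re]
    have e3 : -(w.im * z.im) ≤ |w.im| * R := by
      refine (neg_le_abs _).trans ?_
      rw [abs_mul]
      gcongr
    have e4 : η * ‖z‖ ≤ η * (|z.re| + R) := by gcongr
    have e5 : 2 * Real.pi * (w.re * z.re - w.im * z.im) ≤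
        2 * Real.pi * (w.re * |z.re| + 2 * |w.re| * R + |w.im| * R) := by
      gcongr
      linarith
    refine (add_le_add e4 e5).trans (le_of_eq ?_)
    rw [hη]; ring
  rw [h1, mul_assoc _ (Real.exp (_ + _ + _)), ← Real.exp_add, mul_assoc _ ((n.factorial : ℝ) / _)]
  refine mul_le_mul_of_nonneg_left ?_ (by positivity)
  calc _ ≤ n.factorial / η ^ n * Real.exp (η * ‖z‖) *
        Real.exp (2 * Real.pi * (w.re * z.re - w.im * z.im)) := by gcongr
    _ = n.factorial / η ^ n *
        Real.exp (η * ‖z‖ + 2 * Real.pi * (w.re * z.re - w.im * z.im)) := by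
        rw [mul_assoc, ← Real.exp_add]
    _ ≤ _ := mul_le_mul_of_nonneg_left (Real.exp_le_exp.2 h3) (by positivity)

theorem exists_decay_rightTerm (a : ℂ) {w : ℂ} (j : ℕ) {ρ : ℝ}
    (hρ : ρ < 2 * Real.pi * |w.re|) (R : ℝ) : ∃ C : ℝ, ∀ z : ℂ, |z.im| ≤ R → -R ≤ z.re →
      ‖rightTerm a w j z‖ ≤ C * Real.exp (-ρ * |z.re|) := by
  unfold rightTerm
  split_ifs with h
  · rw [abs_of_neg h] at hρ
    simpa only [norm_neg] using exists_decay_fourierTerm a j hρ R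
  · exact ⟨0, fun z _ _ => by simp⟩

theorem exists_decay_leftTerm (a : ℂ) {w : ℂ} (j : ℕ) {ρ : ℝ}
    (hρ : ρ < 2 * Real.pi * |w.re|) (R : ℝ) : ∃ C : ℝ, ∀ z : ℂ, |z.im| ≤ R → z.re ≤ R →
      ‖leftTerm a w j z‖ ≤ C * Real.exp (-ρ * |z.re|) := by
  unfold leftTerm
  split_ifs with h
  · exact ⟨0, fun z _ _ => by simp⟩
  · rw [abs_of_nonneg (not_lt.1 h)] at hρ
    obtain ⟨C, hC⟩ := exists_decay_fourierTerm (a * (-1) ^ (j - 1)) (w := -w) j (ρ := ρ)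
      (by simpa using hρ) R
    refine ⟨C, fun z him hre => ?_⟩
    have := hC (-z) (by simpa using him) (by simpa using hre)
    rw [← fourierTerm_neg, neg_neg] at this
    simpa using this

theorem integrable_glue_term (a : ℂ) {w : ℂ} (hw : w.re ≠ 0) (j : ℕ) :
    Integrable (glue (rightTerm a w j) (leftTerm a w j)) := by
  have hρ : 0 < Real.pi * |w.re| := mul_pos Real.pi_pos (abs_pos.2 hw)
  have hρ' : Real.pi * |w.re| < 2 * Real.pi * |w.re| := by linarith
  obtain ⟨C, hC⟩ := exists_expDecay_glue (exists_decay_rightTerm a j hρ')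
    (exists_decay_leftTerm a j hρ')
  exact hC.integrable hρ (measurable_glue (differentiable_rightTerm a w j).continuous
    (differentiable_leftTerm a w j).continuous)

theorem fourierInv_glue_term (a : ℂ) {w : ℂ} (hw : w.re ≠ 0) {j : ℕ} (hj : 1 ≤ j) (t : ℝ) :
    𝓕⁻ (glue (rightTerm a w j) (leftTerm a w j)) t = a / ((t : ℂ) - Complex.I * w) ^ j := by
  obtain ⟨n, rfl⟩ : ∃ n, j = n + 1 := ⟨j - 1, by omega⟩
  have hpi : (Real.pi : ℂ) ≠ 0 := by exact_mod_cast Real.pi_ne_zero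
  have hfact : (n.factorial : ℂ) ≠ 0 := by exact_mod_cast n.factorial_ne_zero
  set q : ℂ := (t : ℂ) - Complex.I * w with hq
  have hwq : w + Complex.I * t = Complex.I * q := by
    rw [hq, mul_sub, ← mul_assoc, Complex.I_mul_I]; ring
  have hre : (w + Complex.I * t).re = w.re := by simp
  have hq0 : q ≠ 0 := by
    intro h0
    rw [h0, mul_zero] at hwq
    rw [hwq] at hre
    exact hw hre.symm
  have hI : Complex.I ≠ 0 := Complex.I_ne_zero
  rw [Real.fourierInv_eq']
  rcases lt_or_gt_of_ne hw with hneg | hpos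
  · have hr : 0 < (-(2 * Real.pi * (w + Complex.I * t))).re := by
      have : (-(2 * Real.pi * (w + Complex.I * t))).re = -(2 * Real.pi * w.re) := by simp
      rw [this]
      have := Real.pi_pos
      nlinarith
    have e1 : ∀ v : ℝ, Complex.exp (↑(2 * Real.pi * inner ℝ v t) * Complex.I) •
        glue (rightTerm a w (n + 1)) (leftTerm a w (n + 1)) v =
        (Set.Ioi (0 : ℝ)).indicator (fun v : ℝ =>
          -(2 * Real.pi * Complex.I * a * (-(2 * Real.pi * Complex.I)) ^ n / n.factorial) *
          ((v : ℂ) ^ n * Complex.exp (-(-(2 * Real.pi * (w + Complex.I * t)) * v)))) v := by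
      intro v
      unfold glue
      split_ifs with hv
      · rw [Set.indicator_of_mem (Set.mem_Ioi.2 hv), rightTerm, if_pos hneg, fourierTerm]
        have : Complex.exp (-(-(2 * Real.pi * (w + Complex.I * t)) * v)) =
            Complex.exp (↑(2 * Real.pi * inner ℝ v t) * Complex.I) *
            Complex.exp (2 * Real.pi * w * v) := by
          rw [← Complex.exp_add]
          congr 1
          simp only [RCLike.inner_apply, conj_trivial]
          push_cast; ring
        rw [this, Nat.add_sub_cancel, smul_eq_mul,
          show -(2 * Real.pi * Complex.I * (v : ℂ)) = -(2 * Real.pi * Complex.I) * v by ring,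
          mul_pow]
        ring
      · rw [Set.indicator_of_notMem (by simpa using hv), leftTerm, if_pos hneg, smul_zero]
    simp only [e1]
    rw [integral_indicator measurableSet_Ioi, integral_const_mul, integral_pow_mul_exp_neg hr,
      hwq, show -(2 * Real.pi * (Complex.I * q)) = -(2 * Real.pi * Complex.I) * q by ring, mul_pow]
    have h2 : (-(2 * Real.pi * Complex.I)) ≠ 0 := by simp [hpi]
    field_simp
    ring
  · have hr : 0 < (2 * Real.pi * (w + Complex.I * t)).re := by
      have : (2 * Real.pi * (w + Complex.I * t)).re = 2 * Real.pi * w.re := by simp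
      rw [this]
      have := Real.pi_pos
      positivity
    have hnot : ¬ w.re < 0 := not_lt.2 hpos.le
    have e1 : ∀ v : ℝ, Complex.exp (↑(2 * Real.pi * inner ℝ v t) * Complex.I) •
        glue (rightTerm a w (n + 1)) (leftTerm a w (n + 1)) v =
        (Set.Iic (0 : ℝ)).indicator (fun v : ℝ =>
          (2 * Real.pi * Complex.I * a * (2 * Real.pi * Complex.I) ^ n / n.factorial) *
          (((-v : ℝ) : ℂ) ^ n *
            Complex.exp (-((2 * Real.pi * (w + Complex.I * t)) * ((-v : ℝ) : ℂ))))) v := by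
      intro v
      unfold glue
      split_ifs with hv
      · rw [Set.indicator_of_notMem (by simpa using hv), rightTerm, if_neg hnot, smul_zero]
      · rw [Set.indicator_of_mem (Set.mem_Iic.2 (not_lt.1 hv)), leftTerm, if_neg hnot, fourierTerm]
        have : Complex.exp (-((2 * Real.pi * (w + Complex.I * t)) * ((-v : ℝ) : ℂ))) =
            Complex.exp (↑(2 * Real.pi * inner ℝ v t) * Complex.I) *
            Complex.exp (2 * Real.pi * w * v) := by
          rw [← Complex.exp_add]
          congr 1
          simp only [RCLike.inner_apply, conj_trivial]
          push_cast; ring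
        rw [this, Nat.add_sub_cancel, smul_eq_mul,
          show -(2 * Real.pi * Complex.I * (v : ℂ)) =
            (2 * Real.pi * Complex.I) * ((-v : ℝ) : ℂ) by push_cast; ring,
          mul_pow]
        ring
    simp only [e1]
    rw [integral_indicator measurableSet_Iic, integral_const_mul]
    have h3 := integral_comp_neg_Iic (0 : ℝ) (fun v : ℝ => ((v : ℝ) : ℂ) ^ n *
      Complex.exp (-((2 * Real.pi * (w + Complex.I * t)) * (v : ℂ))))
    rw [neg_zero] at h3
    rw [h3, integral_pow_mul_exp_neg hr,
      hwq, show 2 * Real.pi * (Complex.I * q) = (2 * Real.pi * Complex.I) * q by ring, mul_pow]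
    have h2 : (2 * Real.pi * Complex.I) ≠ 0 := by simp [hpi]
    field_simp
    simp only [mul_pow]
    ring

/-- The Fourier transform of `∑ₖ aₖ / (t - iwₖ)^{jₖ}` on the positive half line. -/
noncomputable def rightSum {n : ℕ} (a w : Fin n → ℂ) (j : Fin n → ℕ) (z : ℂ) : ℂ :=
  ∑ k, rightTerm (a k) (w k) (j k) z

/-- The Fourier transform of `∑ₖ aₖ / (t - iwₖ)^{jₖ}` on the negative half line. -/
noncomputable def leftSum {n : ℕ} (a w : Fin n → ℂ) (j : Fin n → ℕ) (z : ℂ) : ℂ :=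
  ∑ k, leftTerm (a k) (w k) (j k) z

theorem fourierInv_glue_sum {n : ℕ} {a w : Fin n → ℂ} {j : Fin n → ℕ} (hw : ∀ k, (w k).re ≠ 0)
    (hj : ∀ k, 1 ≤ j k) (t : ℝ) :
    𝓕⁻ (glue (rightSum a w j) (leftSum a w j)) t =
      ∑ k, a k / ((t : ℂ) - Complex.I * w k) ^ j k := by
  have h1 : ∀ v : ℝ, glue (rightSum a w j) (leftSum a w j) v =
      ∑ k, glue (rightTerm (a k) (w k) (j k)) (leftTerm (a k) (w k) (j k)) v := by
    intro v
    unfold glue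
    split_ifs <;> rfl
  simp only [← fourierInv_glue_term _ (hw _) (hj _) t]
  simp only [Real.fourierInv_eq', h1, Finset.smul_sum]
  rw [integral_finsetSum]
  intro k _
  refine (integrable_glue_term (a k) (hw k) (j k)).mono ?_ (Eventually.of_forall fun v => ?_)
  · exact (by fun_prop : Continuous fun v : ℝ =>
      Complex.exp (↑(2 * Real.pi * inner ℝ v t) * Complex.I)).aestronglyMeasurable.smul
        (integrable_glue_term (a k) (hw k) (j k)).1
  · rw [norm_smul, Complex.norm_exp_ofReal_mul_I, one_mul]

/-- The polynomial factor of the samples `k ↦ fourierTerm a w j (z + k)`. -/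
noncomputable def samplePoly (a w : ℂ) (j : ℕ) (z : ℂ) : Polynomial ℂ :=
  Polynomial.C (2 * Real.pi * Complex.I * a / ((j - 1).factorial : ℂ) *
    Complex.exp (2 * Real.pi * w * z)) *
    (Polynomial.C (-(2 * Real.pi * Complex.I)) * (Polynomial.X + Polynomial.C z)) ^ (j - 1)

theorem fourierTerm_add_int (a w : ℂ) (j : ℕ) (z : ℂ) (k : ℤ) :
    fourierTerm a w j (z + k) = expPolySeq (Complex.exp (2 * Real.pi * w)) (samplePoly a w j z) k := by
  unfold fourierTerm expPolySeq samplePoly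
  rw [← Complex.exp_int_mul]
  simp only [Polynomial.eval_mul, Polynomial.eval_C, Polynomial.eval_pow, Polynomial.eval_add,
    Polynomial.eval_X]
  rw [show 2 * Real.pi * w * (z + k) = k * (2 * Real.pi * w) + 2 * Real.pi * w * z by ring,
    Complex.exp_add]
  ring

theorem degree_samplePoly_lt (a w : ℂ) {j : ℕ} (hj : 1 ≤ j) (z : ℂ) :
    (samplePoly a w j z).degree < j := by
  have hC : ∀ (c : ℂ) (q : Polynomial ℂ), (Polynomial.C c * q).degree ≤ q.degree := by
    intro c q
    rw [← Polynomial.smul_eq_C_mul]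
    exact Polynomial.degree_smul_le _ _
  unfold samplePoly
  refine (hC _ _).trans_lt ?_
  refine (Polynomial.degree_pow_le _ _).trans_lt ?_
  have h1 : (Polynomial.C (-(2 * Real.pi * Complex.I)) *
      (Polynomial.X + Polynomial.C z)).degree ≤ 1 :=
    (hC _ _).trans (Polynomial.degree_X_add_C z).le
  calc (j - 1) • _ ≤ (j - 1) • (1 : WithBot ℕ) := nsmul_le_nsmul_right h1 _
    _ = ((j - 1 : ℕ) : WithBot ℕ) := by simp
    _ < j := by exact_mod_cast (by omega : j - 1 < j)

/-- The characteristic roots `e^{2πwₖ}`, with multiplicities `jₖ`. -/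
noncomputable def sampleRoots {n : ℕ} (w : Fin n → ℂ) (j : Fin n → ℕ) : Multiset ℂ :=
  ∑ k, Multiset.replicate (j k) (Complex.exp (2 * Real.pi * w k))

theorem exists_eq_exp_of_mem_sampleRoots {n : ℕ} {w : Fin n → ℂ} {j : Fin n → ℕ} {ζ : ℂ}
    (h : ζ ∈ sampleRoots w j) : ∃ k, ζ = Complex.exp (2 * Real.pi * w k) := by
  obtain ⟨k, -, hk⟩ := Multiset.mem_sum.1 h
  exact ⟨k, Multiset.eq_of_mem_replicate hk⟩

theorem prod_sampleRoots {n : ℕ} (w : Fin n → ℂ) (j : Fin n → ℕ) :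
    ((sampleRoots w j).map fun ζ => Polynomial.X - Polynomial.C ζ).prod =
      ∏ k, (Polynomial.X - Polynomial.C (Complex.exp (2 * Real.pi * w k))) ^ j k := by
  unfold sampleRoots
  rw [← Multiset.coe_mapAddMonoidHom, map_sum, Multiset.prod_sum]
  simp

theorem aeval_prod_fourierTerm {n : ℕ} (a w : Fin n → ℂ) {j : Fin n → ℕ} (hj : ∀ k, 1 ≤ j k)
    (i : Fin n) (z : ℂ) :
    Polynomial.aeval seqShift
      ((sampleRoots w j).map fun ζ => Polynomial.X - Polynomial.C ζ).prod
      (fun k : ℤ => fourierTerm (a i) (w i) (j i) (z + k)) = 0 := by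
  classical
  rw [prod_sampleRoots, ← Finset.prod_erase_mul _ _ (Finset.mem_univ i), map_mul,
    Module.End.mul_apply, map_pow, map_sub, Polynomial.aeval_X, Polynomial.aeval_C]
  simp only [fourierTerm_add_int]
  have := seqShift_sub_pow_expPolySeq (Complex.exp_ne_zero (2 * Real.pi * w i)) (j i)
    (degree_samplePoly_lt (a i) (w i) (hj i) z)
  unfold expPolySeq at this ⊢
  rw [this, map_zero]

theorem aeval_prod_rightSum {n : ℕ} (a w : Fin n → ℂ) {j : Fin n → ℕ} (hj : ∀ k, 1 ≤ j k)
    (z : ℂ) : Polynomial.aeval seqShift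
      ((sampleRoots w j).map fun ζ => Polynomial.X - Polynomial.C ζ).prod
      (fun k : ℤ => rightSum a w j (z + k)) = 0 := by
  have : (fun k : ℤ => rightSum a w j (z + k)) =
      ∑ i, fun k : ℤ => rightTerm (a i) (w i) (j i) (z + k) := by
    ext k; simp [rightSum]
  rw [this, map_sum]
  refine Finset.sum_eq_zero fun i _ => ?_
  unfold rightTerm
  split_ifs
  · have h := aeval_prod_fourierTerm a w hj i z
    rw [← neg_eq_zero, ← map_neg] at h
    exact h
  · exact map_zero _

theorem aeval_prod_leftSum {n : ℕ} (a w : Fin n → ℂ) {j : Fin n → ℕ} (hj : ∀ k, 1 ≤ j k)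
    (z : ℂ) : Polynomial.aeval seqShift
      ((sampleRoots w j).map fun ζ => Polynomial.X - Polynomial.C ζ).prod
      (fun k : ℤ => leftSum a w j (z + k)) = 0 := by
  have : (fun k : ℤ => leftSum a w j (z + k)) =
      ∑ i, fun k : ℤ => leftTerm (a i) (w i) (j i) (z + k) := by
    ext k; simp [leftSum]
  rw [this, map_sum]
  refine Finset.sum_eq_zero fun i _ => ?_
  unfold leftTerm
  split_ifs
  · exact map_zero _
  · exact aeval_prod_fourierTerm a w hj i z

theorem exists_decay_sum {n : ℕ} {ρ : ℝ} {f : Fin n → ℂ → ℂ} {S : Set ℂ}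
    (hf : ∀ k, ∃ C : ℝ, ∀ z ∈ S, ‖f k z‖ ≤ C * Real.exp (-ρ * |z.re|)) :
    ∃ C : ℝ, ∀ z ∈ S, ‖∑ k, f k z‖ ≤ C * Real.exp (-ρ * |z.re|) := by
  choose C hC using hf
  refine ⟨∑ k, C k, fun z hz => (norm_sum_le _ _).trans ?_⟩
  rw [Finset.sum_mul]
  exact Finset.sum_le_sum fun k _ => hC k z hz

/-- A sequence killed by a polynomial in the shift vanishes if it vanishes at more consecutive
places than the degree. -/
theorem eq_zero_of_aeval_of_forall {s : Multiset ℂ} {v : ℤ → ℂ}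
    (h : Polynomial.aeval seqShift (s.map fun ζ => Polynomial.X - Polynomial.C ζ).prod v = 0)
    (m : ℤ) (hv : ∀ i < s.card + 1, v (m + (i : ℕ)) = 0) : v = 0 := by
  have hdeg : (s.map fun ζ => Polynomial.X - Polynomial.C ζ).prod.natDegree < s.card + 1 := by
    rw [Polynomial.natDegree_multiset_prod_X_sub_C_eq_card]
    exact Nat.lt_succ_self _
  refine eq_zero_of_recurrence (M := s.card + 1)
    (r := (s.map fun ζ => Polynomial.X - Polynomial.C ζ).prod.coeff)
    ⟨s.card, Nat.lt_succ_self _, ?_⟩ (fun k => ?_) hv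
  · rw [← Polynomial.natDegree_multiset_prod_X_sub_C_eq_card s]
    exact Polynomial.leadingCoeff_ne_zero.2
      (Polynomial.monic_multisetProd_X_sub_C s).ne_zero
  · have := congrFun h k
    rw [aeval_seqShift_apply hdeg] at this
    simpa only [add_comm k, Pi.zero_apply] using this

/-- The Fourier transform of a window of the class `𝒦₁(M)` is glued from a decay pair. If both
branches vanished on a translate `y + ℤ`, linear independence of exponential polynomials would
produce a zero of the function in the definition of `𝒦₁(M)` at `y - 2`; this needs no
agreement between the signs of `2πi` in that function and in the Fourier transform. -/
theorem isDecayPair_of_rational {n M : ℕ} {a w : Fin n → ℂ} {j : Fin n → ℕ}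
    (hw : ∀ k, (w k).re ≠ 0) (hj : ∀ k, 1 ≤ j k) (hM : ∑ k, j k = M)
    (hne : ∀ t : ℝ, t < 0 →
      ∑ k, a k * Complex.exp (2 * (Real.pi : ℂ) * w k * (t : ℂ)) *
        ((2 * (Real.pi : ℂ) * Complex.I) ^ (j k - 1) / ((j k - 1).factorial : ℂ)) *
        (t : ℂ) ^ (j k - 1) ≠ 0) :
    ∃ ρ, IsDecayPair M ρ (rightSum a w j) (leftSum a w j) := by
  obtain ⟨ρ, hρ, hρ0⟩ : ∃ ρ : ℝ, (∀ k, ρ < 2 * Real.pi * |(w k).re|) ∧ 0 < ρ := by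
    have h1 : ∀ᶠ ρ in 𝓝[>] (0 : ℝ), ∀ k, ρ < 2 * Real.pi * |(w k).re| :=
      eventually_all.2 fun k => by
        have h0 : 0 < 2 * Real.pi * |(w k).re| :=
          mul_pos (mul_pos two_pos Real.pi_pos) (abs_pos.2 (hw k))
        filter_upwards [Ioo_mem_nhdsGT h0] with ρ hρ using hρ.2
    exact (h1.and self_mem_nhdsWithin).exists
  refine ⟨ρ, hρ0, ?_, ?_, fun R => ?_, fun R => ?_, ⟨sampleRoots w j, ?_, ?_, ?_,
    aeval_prod_rightSum a w hj, aeval_prod_leftSum a w hj⟩, ?_⟩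
  · exact Differentiable.fun_sum fun k _ => differentiable_rightTerm _ _ _
  · exact Differentiable.fun_sum fun k _ => differentiable_leftTerm _ _ _
  · obtain ⟨C, hC⟩ := exists_decay_sum (S := {z : ℂ | |z.im| ≤ R ∧ -R ≤ z.re}) fun k =>
      (exists_decay_rightTerm (a k) (j k) (hρ k) R).imp fun C hC z hz => hC z hz.1 hz.2
    exact ⟨C, fun z h1 h2 => hC z ⟨h1, h2⟩⟩
  · obtain ⟨C, hC⟩ := exists_decay_sum (S := {z : ℂ | |z.im| ≤ R ∧ z.re ≤ R}) fun k =>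
      (exists_decay_leftTerm (a k) (j k) (hρ k) R).imp fun C hC z hz => hC z hz.1 hz.2
    exact ⟨C, fun z h1 h2 => hC z ⟨h1, h2⟩⟩
  · simp [sampleRoots, hM]
  · intro ζ hζ
    obtain ⟨k, rfl⟩ := exists_eq_exp_of_mem_sampleRoots hζ
    exact Complex.exp_ne_zero _
  · intro ζ hζ
    obtain ⟨k, rfl⟩ := exists_eq_exp_of_mem_sampleRoots hζ
    rw [Complex.norm_exp]
    simpa [Real.pi_ne_zero] using hw k
  · intro y _
    by_contra! hcon
    obtain ⟨hR, hL⟩ := hcon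
    have hR0 := eq_zero_of_aeval_of_forall (aeval_prod_rightSum a w hj y) 0
      (fun i _ => hR _ (by omega))
    have hL0 := eq_zero_of_aeval_of_forall (aeval_prod_leftSum a w hj y)
      (-((sampleRoots w j).card + 1)) (fun i hi => hL _ (by omega))
    have hzero : ∀ k : ℤ, ∑ i, Complex.exp (2 * Real.pi * w i) ^ k *
        (samplePoly (a i) (w i) (j i) y).eval (k : ℂ) = 0 := by
      intro k
      have h1 : rightSum a w j (y + k) - leftSum a w j (y + k) = 0 := by
        have e1 := congrFun hR0 k
        have e2 := congrFun hL0 k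
        simp only [Pi.zero_apply] at e1 e2
        rw [e1, e2, sub_zero]
      unfold rightSum leftSum at h1
      rw [← Finset.sum_sub_distrib] at h1
      simp only [rightTerm_sub_leftTerm, Finset.sum_neg_distrib, neg_eq_zero,
        fourierTerm_add_int] at h1
      exact h1
    -- with `χ(ζ) = ζ⁻²` the exponential factors become `e^{2πw(y - 2)}`, and evaluating the
    -- polynomial factors at `s = 2 - 2y` turns `-2πi(y + s)` into `2πi(y - 2)`
    have h2 := sum_expPoly_eq_zero (fun i => Complex.exp_ne_zero _) hzero (fun ζ => ζ ^ (-2 : ℤ))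
      (2 - 2 * y)
    have hy : y - 2 < 0 := by
      have := (‹y ∈ Set.Icc (0 : ℝ) 1›).2
      linarith
    refine hne (y - 2) hy ?_
    have h3 : (2 * Real.pi * Complex.I) ≠ 0 := by simp [Real.pi_ne_zero]
    refine (mul_eq_zero.1 (Eq.trans ?_ h2)).resolve_left h3
    rw [Finset.mul_sum]
    refine Finset.sum_congr rfl fun i _ => ?_
    unfold samplePoly
    simp only [Polynomial.eval_mul, Polynomial.eval_C, Polynomial.eval_pow, Polynomial.eval_add,
      Polynomial.eval_X]
    rw [← Complex.exp_int_mul,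
      show 2 * Real.pi * w i * ((y - 2 : ℝ) : ℂ) =
        ((-2 : ℤ) : ℂ) * (2 * Real.pi * w i) + 2 * Real.pi * w i * y by push_cast; ring,
      Complex.exp_add,
      show -(2 * Real.pi * Complex.I) * (2 - 2 * (y : ℂ) + y) =
        (2 * Real.pi * Complex.I) * ((y - 2 : ℝ) : ℂ) by push_cast; ring, mul_pow]
    ring

/-! ### The frequency set and its density -/

/-- The integers whose residue modulo `K` is less than `M`. -/
def blockSet (K M : ℕ) : Set ℤ := {l | l % K < M}

/-- The offset `1 / (v + 2)`, where `v` is the 2-adic valuation of `⌊l / K⌋`; it is constant on the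
blocks of `blockSet K M`, and each value recurs periodically. -/
noncomputable def blockShift (K : ℕ) (l : ℤ) : ℝ := 1 / ((padicValInt 2 (l / K) : ℝ) + 2)

theorem one_div_nat_add_two_mem (n : ℕ) : 1 / ((n : ℝ) + 2) ∈ Set.Ioo (0 : ℝ) 1 := by
  refine ⟨by positivity, ?_⟩
  rw [div_lt_one (by positivity)]
  have : (0 : ℝ) ≤ n := n.cast_nonneg
  linarith

theorem blockShift_mem (K : ℕ) (l : ℤ) : blockShift K l ∈ Set.Ioo (0 : ℝ) 1 :=
  one_div_nat_add_two_mem _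

theorem padicValInt_two_pow_mul_odd (n : ℕ) (t : ℤ) : padicValInt 2 (2 ^ n * (2 * t + 1)) = n := by
  have : Fact (Nat.Prime 2) := ⟨Nat.prime_two⟩
  have h1 : (2 * t + 1).natAbs ≠ 0 := by omega
  rw [padicValInt, Int.natAbs_mul, padicValNat.mul (by simp) h1, Int.natAbs_pow]
  rw [show (2 : ℤ).natAbs = 2 from rfl, padicValNat.prime_pow,
    padicValNat.eq_zero_of_not_dvd (by omega), add_zero]

theorem block_div {K M : ℕ} (hMK : M ≤ K) {i : ℕ} (hi : i < M) (q : ℤ) :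
    ((K : ℤ) * q + i) / K = q := by
  have hK : (K : ℤ) ≠ 0 := by omega
  rw [Int.mul_add_ediv_left _ _ hK, Int.ediv_eq_zero_of_lt (by omega) (by omega), add_zero]

theorem block_mod {K M : ℕ} (hMK : M ≤ K) {i : ℕ} (hi : i < M) (q : ℤ) :
    ((K : ℤ) * q + i) % K = i := by
  rw [Int.mul_add_emod_self_left, Int.emod_eq_of_lt (by omega) (by omega)]

theorem isBlockPattern_blockSet {K M : ℕ} (hK : 0 < K) (hMK : M ≤ K) :
    IsBlockPattern M (blockSet K M) (blockShift K) (fun n => 1 / ((n : ℝ) + 2)) where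
  shift_mem := blockShift_mem K
  mem := one_div_nat_add_two_mem
  tendsto := by
    have h := (tendsto_one_div_add_atTop_nhds_zero_nat (𝕜 := ℝ)).comp (tendsto_add_atTop_nat 1)
    refine h.congr fun n => ?_
    simp only [Function.comp_apply]
    push_cast
    ring_nf
  exists_block := by
    intro n
    refine ⟨K * 2 ^ (n + 1), fun m => ?_⟩
    set D : ℤ := (K : ℤ) * 2 ^ (n + 1) with hD
    have hDpos : 0 < D := by positivity
    have h1 := Int.emod_nonneg m hDpos.ne'
    have h2 := Int.emod_lt_of_pos m hDpos
    have h3 := Int.mul_ediv_add_emod m D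
    refine ⟨(K : ℤ) * 2 ^ n - m % D, ?_, fun i hi => ?_⟩
    · have h4 : D = 2 * ((K : ℤ) * 2 ^ n) := by rw [hD]; ring
      have h5 : 0 < (K : ℤ) * 2 ^ n := by positivity
      rw [abs_le]
      push_cast
      rw [← hD]
      constructor <;> omega
    · have e : (K : ℤ) * 2 ^ n - m % D + i + m = K * (2 ^ n * (2 * (m / D) + 1)) + i := by
        have : m - m % D = D * (m / D) := by linarith
        calc _ = (K : ℤ) * 2 ^ n + (m - m % D) + i := by ring
          _ = _ := by rw [this, hD]; ring
      rw [e]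
      refine ⟨?_, ?_⟩
      · unfold blockSet
        rw [Set.mem_ofPred_eq, block_mod hMK hi]
        exact_mod_cast hi
      · rw [blockShift, block_div hMK hi, padicValInt_two_pow_mul_odd]

theorem card_Icc_ceil_floor_le {u v : ℝ} (h : u ≤ v) :
    ((Finset.Icc ⌈u⌉ ⌊v⌋).card : ℝ) ≤ v - u + 1 := by
  rw [Int.card_Icc]
  have h1 : ((⌊v⌋ + 1 - ⌈u⌉).toNat : ℝ) = max ((⌊v⌋ : ℝ) + 1 - ⌈u⌉) 0 := by
    have := Int.ofNat_toNat (⌊v⌋ + 1 - ⌈u⌉)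
    have h2 : (((⌊v⌋ + 1 - ⌈u⌉).toNat : ℤ) : ℝ) = ((max (⌊v⌋ + 1 - ⌈u⌉) 0 : ℤ) : ℝ) := by
      rw [this]
    push_cast at h2
    exact h2
  rw [h1]
  refine max_le ?_ (by linarith)
  linarith [Int.floor_le v, Int.le_ceil u]

/-- All integers, together with one shifted copy of each block of `M` consecutive
integers starting at a multiple of `K`. -/
noncomputable def frequencySet (K M : ℕ) : Set ℝ :=
  Set.range (frequencyPoint (E := blockSet K M) (blockShift K))

theorem encard_frequencySet_inter_le {K M : ℕ} (hK : 0 < K) {a : ℝ} (ha : 0 ≤ a) (R : ℝ) :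
    ((frequencySet K M ∩ Set.Icc R (R + a)).encard : ℝ≥0∞) ≤
      ENNReal.ofReal (a + 1 + M * ((a + 1) / K + 1)) := by
  classical
  have hK' : (0 : ℝ) < K := by exact_mod_cast hK
  set F1 : Finset ℝ := (Finset.Icc ⌈R⌉ ⌊R + a⌋).image fun l : ℤ => (l : ℝ) with hF1
  set F2 : Finset ℝ := (Finset.range M).biUnion fun i =>
    (Finset.Icc ⌈(R - 1 - i) / K⌉ ⌊(R + a - i) / K⌋).image fun q : ℤ =>
      (((K : ℤ) * q + i : ℤ) : ℝ) + blockShift K ((K : ℤ) * q + i) with hF2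
  have hsub : frequencySet K M ∩ Set.Icc R (R + a) ⊆ ((F1 ∪ F2 : Finset ℝ) : Set ℝ) := by
    rintro _ ⟨⟨l | l, rfl⟩, h1, h2⟩
    · rw [Finset.coe_union]
      refine Or.inl ?_
      simp only [frequencyPoint, Sum.elim_inl] at h1 h2 ⊢
      rw [hF1, Finset.mem_coe, Finset.mem_image]
      exact ⟨l, Finset.mem_Icc.2 ⟨Int.ceil_le.2 h1, Int.le_floor.2 h2⟩, rfl⟩
    · rw [Finset.coe_union]
      refine Or.inr ?_
      obtain ⟨l, hl⟩ := l
      simp only [frequencyPoint, Sum.elim_inr] at h1 h2 ⊢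
      have hb := blockShift_mem K l
      have hmod := Int.emod_nonneg l (by omega : (K : ℤ) ≠ 0)
      unfold blockSet at hl
      rw [Set.mem_ofPred_eq] at hl
      have hdiv := Int.mul_ediv_add_emod l K
      obtain ⟨i, hi⟩ := Int.eq_ofNat_of_zero_le hmod
      rw [hi] at hdiv hl
      have hcast : (K : ℝ) * ((l / K : ℤ) : ℝ) + i = l := by exact_mod_cast hdiv
      rw [hF2, Finset.mem_coe, Finset.mem_biUnion]
      refine ⟨i, Finset.mem_range.2 (by exact_mod_cast hl), Finset.mem_image.2 ⟨l / K, ?_, ?_⟩⟩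
      · rw [Finset.mem_Icc, Int.ceil_le, Int.le_floor, div_le_iff₀ hK', le_div_iff₀ hK']
        constructor <;> nlinarith [hb.1, hb.2]
      · rw [hdiv]
  have hcard : ((F1 ∪ F2).card : ℝ) ≤ a + 1 + M * ((a + 1) / K + 1) := by
    have h1 : (F1.card : ℝ) ≤ a + 1 := by
      have e1 : F1.card ≤ (Finset.Icc ⌈R⌉ ⌊R + a⌋).card := Finset.card_image_le
      have e2 := card_Icc_ceil_floor_le (u := R) (v := R + a) (by linarith)
      have e3 : (F1.card : ℝ) ≤ (Finset.Icc ⌈R⌉ ⌊R + a⌋).card := by exact_mod_cast e1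
      linarith
    have h2 : (F2.card : ℝ) ≤ M * ((a + 1) / K + 1) := by
      have e1 : (F2.card : ℝ) ≤ ((∑ i ∈ Finset.range M,
          (Finset.Icc ⌈(R - 1 - i) / K⌉ ⌊(R + a - i) / K⌋).card : ℕ) : ℝ) := by
        exact_mod_cast Finset.card_biUnion_le.trans
          (Finset.sum_le_sum fun i _ => Finset.card_image_le)
      refine e1.trans ?_
      push_cast
      calc ∑ i ∈ Finset.range M,
            ((Finset.Icc ⌈(R - 1 - (i : ℝ)) / K⌉ ⌊(R + a - (i : ℝ)) / K⌋).card : ℝ)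
          ≤ ∑ _i ∈ Finset.range M, ((a + 1) / K + 1) := Finset.sum_le_sum fun i _ => by
            have h := card_Icc_ceil_floor_le (u := (R - 1 - (i : ℝ)) / K)
              (v := (R + a - (i : ℝ)) / K) (by gcongr; linarith)
            have e : (R + a - i) / K - (R - 1 - i) / K + 1 = (a + 1) / K + 1 := by ring
            rwa [e] at h
        _ = M * ((a + 1) / K + 1) := by
            rw [Finset.sum_const, Finset.card_range, nsmul_eq_mul]
    have h3 : ((F1 ∪ F2).card : ℝ) ≤ F1.card + F2.card := by
      exact_mod_cast Finset.card_union_le F1 F2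
    linarith
  calc ((frequencySet K M ∩ Set.Icc R (R + a)).encard : ℝ≥0∞)
      ≤ ((((F1 ∪ F2 : Finset ℝ) : Set ℝ).encard : ℕ∞) : ℝ≥0∞) :=
        ENat.toENNReal_le.2 (Set.encard_le_encard hsub)
    _ = ENNReal.ofReal ((F1 ∪ F2).card : ℝ) := by
        rw [Set.encard_coe_eq_coe_finsetCard, ENat.toENNReal_coe, ENNReal.ofReal_natCast]
    _ ≤ _ := ENNReal.ofReal_le_ofReal hcard

theorem le_encard_frequencySet_inter {K M : ℕ} (hK : 0 < K) (hMK : M ≤ K) (a : ℝ) :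
    ENNReal.ofReal (a + M * (a / K - 1)) ≤
      ((frequencySet K M ∩ Set.Icc 0 (0 + a)).encard : ℝ≥0∞) := by
  classical
  have hK' : (0 : ℝ) < K := by exact_mod_cast hK
  have hinj := frequencyPoint_injective (E := blockSet K M) (blockShift_mem K)
  have hmem : ∀ (q : ℤ) (i : Fin M), (K : ℤ) * q + (i : ℕ) ∈ blockSet K M := by
    intro q i
    unfold blockSet
    rw [Set.mem_ofPred_eq, block_mod hMK i.2]
    exact_mod_cast i.2
  let e : ℤ ⊕ (ℤ × Fin M) → ℤ ⊕ blockSet K M :=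
    Sum.map id fun p => ⟨(K : ℤ) * p.1 + (p.2 : ℕ), hmem p.1 p.2⟩
  have he : Function.Injective e := by
    refine Function.injective_id.sumMap ?_
    rintro ⟨q, i⟩ ⟨q', i'⟩ h
    have h0 : (K : ℤ) * q + (i : ℕ) = (K : ℤ) * q' + (i' : ℕ) := congrArg Subtype.val h
    have h1 := congrArg (fun l : ℤ => l / K) h0
    have h2 := congrArg (fun l : ℤ => l % K) h0
    simp only [block_div hMK i.2, block_div hMK i'.2] at h1
    simp only [block_mod hMK i.2, block_mod hMK i'.2] at h2
    exact Prod.ext h1 (Fin.ext (by exact_mod_cast h2))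
  set F : Finset (ℤ ⊕ (ℤ × Fin M)) := (Finset.Icc 0 ⌊a⌋).disjSum
    (Finset.Icc 0 (⌊a / K⌋ - 1) ×ˢ Finset.univ) with hF
  have hsub : ((F.image (frequencyPoint (blockShift K) ∘ e) : Finset ℝ) : Set ℝ) ⊆
      frequencySet K M ∩ Set.Icc 0 (0 + a) := by
    intro x hx
    rw [Finset.mem_coe, Finset.mem_image] at hx
    obtain ⟨p, hp, rfl⟩ := hx
    refine ⟨⟨e p, rfl⟩, ?_⟩
    rw [zero_add]
    rcases p with l | ⟨q, i⟩
    · simp only [hF, Finset.inl_mem_disjSum, Finset.mem_Icc] at hp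
      show (0 : ℝ) ≤ (l : ℝ) ∧ (l : ℝ) ≤ a
      exact ⟨by exact_mod_cast hp.1, Int.le_floor.1 hp.2⟩
    · simp only [hF, Finset.inr_mem_disjSum, Finset.mem_product, Finset.mem_Icc] at hp
      obtain ⟨⟨h1, h2⟩, -⟩ := hp
      have hb := blockShift_mem K ((K : ℤ) * q + (i : ℕ))
      have h3 : ((q + 1 : ℤ) : ℝ) ≤ a / K := Int.le_floor.1 (by omega)
      rw [le_div_iff₀ hK'] at h3
      have h4 : (0 : ℝ) ≤ q := by exact_mod_cast h1
      have h5 : ((i : ℕ) : ℝ) + 1 ≤ K := by exact_mod_cast i.2.trans_le hMK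
      have h6 : (0 : ℝ) ≤ (i : ℕ) := Nat.cast_nonneg _
      simp only [e, Function.comp_apply, Sum.map_inr, frequencyPoint, Sum.elim_inr]
      push_cast at h3 ⊢
      constructor
      · have := hb.1
        positivity
      · have := hb.2
        nlinarith
  have hcard : a + M * (a / K - 1) ≤ (F.card : ℝ) := by
    rw [hF, Finset.card_disjSum, Finset.card_product, Int.card_Icc, Int.card_Icc,
      Finset.card_univ, Fintype.card_fin]
    have h1 : a ≤ ((⌊a⌋ + 1 - 0).toNat : ℝ) := by
      have h2 : ((⌊a⌋ + 1 - 0 : ℤ) : ℝ) ≤ ((⌊a⌋ + 1 - 0).toNat : ℝ) := by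
        exact_mod_cast Int.self_le_toNat _
      push_cast at h2
      linarith [Int.lt_floor_add_one a]
    have h3 : a / K - 1 ≤ ((⌊a / K⌋ - 1 + 1 - 0).toNat : ℝ) := by
      have h2 : ((⌊a / K⌋ - 1 + 1 - 0 : ℤ) : ℝ) ≤ ((⌊a / K⌋ - 1 + 1 - 0).toNat : ℝ) := by
        exact_mod_cast Int.self_le_toNat _
      push_cast at h2
      linarith [Int.lt_floor_add_one (a / K)]
    have h4 : (0 : ℝ) ≤ M := Nat.cast_nonneg _
    push_cast
    nlinarith
  calc ENNReal.ofReal (a + M * (a / K - 1)) ≤ ENNReal.ofReal (F.card : ℝ) :=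
        ENNReal.ofReal_le_ofReal hcard
    _ = ((((F.image (frequencyPoint (blockShift K) ∘ e) : Finset ℝ) : Set ℝ).encard : ℕ∞) :
          ℝ≥0∞) := by
        rw [Set.encard_coe_eq_coe_finsetCard, ENat.toENNReal_coe, ENNReal.ofReal_natCast,
          Finset.card_image_of_injective _ (hinj.comp he)]
    _ ≤ _ := ENat.toENNReal_le.2 (Set.encard_le_encard hsub)

theorem hasUpperDensity_frequencySet {K M : ℕ} (hK : 0 < K) (hMK : M ≤ K) :
    HasUpperDensity (frequencySet K M) (ENNReal.ofReal (1 + M / K)) := by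
  have hK' : (0 : ℝ) < K := by exact_mod_cast hK
  have hlim : ∀ b : ℝ, Tendsto (fun a : ℝ => ENNReal.ofReal (1 + M / K + b / a)) atTop
      (𝓝 (ENNReal.ofReal (1 + M / K))) := by
    intro b
    refine ENNReal.tendsto_ofReal ?_
    simpa using (tendsto_const_nhds (x := (1 : ℝ) + M / K)).add
      (tendsto_const_nhds.div_atTop (tendsto_id (α := ℝ)) : Tendsto (fun a : ℝ => b / a) atTop _)
  refine tendsto_of_tendsto_of_tendsto_of_le_of_le' (hlim (-M)) (hlim (1 + M / K + M)) ?_ ?_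
  · filter_upwards [eventually_gt_atTop 0] with a ha
    refine le_trans ?_ (le_iSup _ (0 : ℝ))
    refine le_trans (le_of_eq ?_)
      (ENNReal.div_le_div_right (le_encard_frequencySet_inter hK hMK a) _)
    rw [← ENNReal.ofReal_div_of_pos ha]
    congr 1
    field_simp
    ring
  · filter_upwards [eventually_gt_atTop 0] with a ha
    refine iSup_le fun R => ?_
    refine (ENNReal.div_le_div_right (encard_frequencySet_inter_le hK ha.le R) _).trans
      (le_of_eq ?_)
    rw [← ENNReal.ofReal_div_of_pos ha]
    congr 1
    field_simp
    ring

theorem theorem2 (ε : ℝ) (hε : 0 < ε) (M : ℕ) :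
    ∃ Λ : Set ℝ,
      (∃ D : ℝ≥0∞, HasUpperDensity Λ D ∧ D ≤ ENNReal.ofReal (1 + ε)) ∧
      ∀ g ∈ RationalWindows M,
        IsGaborFrame g (Λ ×ˢ Set.range (fun n : ℤ => (n : ℝ))) := by
  obtain ⟨K, hK⟩ := exists_nat_ge (max (M / ε) (M + 1))
  have hK1 : (M : ℝ) / ε ≤ K := (le_max_left _ _).trans hK
  have hK2 : M + 1 ≤ K := by exact_mod_cast (le_max_right _ _).trans hK
  have hKpos : 0 < K := by omega
  have hK' : (0 : ℝ) < K := by exact_mod_cast hKpos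
  refine ⟨frequencySet K M, ⟨_, hasUpperDensity_frequencySet hKpos (by omega),
    ENNReal.ofReal_le_ofReal ?_⟩, ?_⟩
  · rw [div_le_iff₀ hε] at hK1
    have : (M : ℝ) / K ≤ ε := by
      rw [div_le_iff₀ hK']
      linarith
    linarith
  · rintro g ⟨n, a, w, j, hw, hj, hM, hg, hne⟩
    obtain ⟨ρ, hpair⟩ := isDecayPair_of_rational hw hj hM hne
    have hgeq : g = 𝓕⁻ (glue (rightSum a w j) (leftSum a w j)) :=
      funext fun t => (hg t).trans (fourierInv_glue_sum hw hj t).symm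
    rw [hgeq]
    exact hpair.isGaborFrame (isBlockPattern_blockSet hKpos (by omega))
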